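/- Let $d\ge 1$ and $\beta\in(0,2)$. For $t>0$, $x\in\mathbb{R}^d$ let $$G^{(\beta)}(t,x)=\frac{1}{(2\pi)^d}\int_{\mathbb{R}^d}e^{i x\cdot\xi}\,e^{-t|\xi|^\beta}\,\mathrm{d}\xi$$ be the fractional heat kernel, and put $\Phi_\beta(y)=G^{(\beta)}(1,y)$ and $c_{\beta,d}=\dfrac{2^\beta\,\Gamma(\frac{d+\beta}{2})}{\pi^{d/2}\,|\Gamma(-\frac{\beta}{2})|}$. For a function $f:\mathbb{R}^d\to\mathbb{R}$ let $$(-\Delta)^{\frac{\beta}{2}}f(x)=-c_{\beta,d}\lim_{\varepsilon\to0^+}\int_{|x-y|\ge\varepsilon}\frac{f(y)-f(x)}{|x-y|^{d+\beta}}\,\mathrm{d}y=-\frac{c_{\beta,d}}{2}\int_{\mathbb{R}^d}\frac{f(x+h)+f(x-h)-2f(x)}{|h|^{d+\beta}}\,\mathrm{d}h$$ whenever these expressions exist and agree. Then $G^{(\beta)}(t,x)>0$ for all $t>0$ and $x\in\mathbb{R}^d$. For every $y\in\mathbb{R}^d$ the integral in $$C_{LY}(\beta,d)=\frac{c_{\beta,d}}{2}\,\sup_{y\in\mathbb{R}^d}\int_{\mathbb{R}^d}\frac{\log\Big(\frac{\Phi_\beta(y)^2}{\Phi_\beta(y+\sigma)\,\Phi_\beta(y-\sigma)}\Big)}{|\sigma|^{d+\beta}}\,\mathrm{d}\sigma$$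 converges absolutely, and $0<C_{LY}(\beta,d)<\infty$. Moreover, for all $t>0$ and $x\in\mathbb{R}^d$, $(-\Delta)^{\beta/2}(\log G^{(\beta)}(t,\cdot))(x)$ exists (both expressions above, with absolutely convergent integrals, exist and agree for $f=\log G^{(\beta)}(t,\cdot)$), and $$(-\Delta)^{\frac{\beta}{2}}\big(\log G^{(\beta)}(t,\cdot)\big)(x)\le\frac{C_{LY}(\beta,d)}{t}.$$ -/

import Mathlib

open scoped FourierTransform

noncomputable section

/-- The normalizing constant
`c_{β,d} = 2^β Γ((d+β)/2) / (π^{d/2} |Γ(-β/2)|)` of the fractional Laplacian. -/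
def fracConst (β : ℝ) (d : ℕ) : ℝ :=
  2 ^ β * Real.Gamma (((d : ℝ) + β) / 2) /
    (Real.pi ^ ((d : ℝ) / 2) * |Real.Gamma (-(β / 2))|)

/-- The integrand `(f(x+h) + f(x-h) - 2 f(x)) / |h|^{d+β}`, as a function of `h`. -/
def secondDiffQuot {d : ℕ} (β : ℝ) (f : EuclideanSpace ℝ (Fin d) → ℝ)
    (x h : EuclideanSpace ℝ (Fin d)) : ℝ :=
  (f (x + h) + f (x - h) - 2 * f x) / ‖h‖ ^ ((d : ℝ) + β)

/-- The fractional Laplacian `(-Δ)^{β/2} f (x)` in its pointwise form, i.e.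
`-(-Δ)^{β/2} f (x) = (c_{β,d} / 2) ∫ (f(x+h) + f(x-h) - 2 f(x)) / |h|^{d+β} dh`.
It is meaningful when `secondDiffQuot β f x` is integrable. -/
def fracLaplacian {d : ℕ} (β : ℝ) (f : EuclideanSpace ℝ (Fin d) → ℝ)
    (x : EuclideanSpace ℝ (Fin d)) : ℝ :=
  -(fracConst β d / 2 * ∫ h, secondDiffQuot β f x h)

/-- The principal value form: `(-Δ)^{β/2} f (x)` exists and equals `a` in the sense that
`-(-Δ)^{β/2} f (x) = c_{β,d} lim_{ε → 0+} ∫_{|x-y| ≥ ε} (f(y) - f(x)) / |x-y|^{d+β} dy`,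
where all the truncated integrals converge absolutely. -/
def HasFracLaplacianPV {d : ℕ} (β : ℝ) (f : EuclideanSpace ℝ (Fin d) → ℝ)
    (x : EuclideanSpace ℝ (Fin d)) (a : ℝ) : Prop :=
  (∀ ε : ℝ, 0 < ε → MeasureTheory.IntegrableOn
      (fun y => (f y - f x) / ‖x - y‖ ^ ((d : ℝ) + β)) (Metric.ball x ε)ᶜ) ∧
  Filter.Tendsto
    (fun ε : ℝ => -(fracConst β d *
      ∫ y in (Metric.ball x ε)ᶜ, (f y - f x) / ‖x - y‖ ^ ((d : ℝ) + β)))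
    (nhdsWithin 0 (Set.Ioi 0)) (nhds a)

/-- The fractional heat kernel `G^{(β)}(t, x)`: the inverse Fourier transform of
`ξ ↦ exp(-t |ξ|^β)`, that is `(2π)^{-d} ∫ exp(i x·ξ) exp(-t |ξ|^β) dξ`. Mathlib's inverse
Fourier transform has the phase `exp(2π i x·ξ)` and no prefactor, which is the same after
the substitution `ξ → 2π ξ`. The integral is real, its symbol being even and real. -/
def fracHeatKernel {d : ℕ} (β t : ℝ) (x : EuclideanSpace ℝ (Fin d)) : ℝ :=
  (𝓕⁻ (fun ξ : EuclideanSpace ℝ (Fin d) =>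
    ((Real.exp (-(t * (2 * Real.pi * ‖ξ‖) ^ β)) : ℝ) : ℂ)) x).re

/-- The profile `Φ_β(y) = G^{(β)}(1, y)`. -/
def fracProfile {d : ℕ} (β : ℝ) (y : EuclideanSpace ℝ (Fin d)) : ℝ :=
  fracHeatKernel β 1 y

/-- The integrand `log (Φ_β(y)² / (Φ_β(y+σ) Φ_β(y-σ))) / |σ|^{d+β}`, as a function of `σ`. -/
def liYauIntegrand {d : ℕ} (β : ℝ) (y σ : EuclideanSpace ℝ (Fin d)) : ℝ :=
  Real.log (fracProfile β y ^ 2 / (fracProfile β (y + σ) * fracProfile β (y - σ))) /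
    ‖σ‖ ^ ((d : ℝ) + β)

/-- The Li-Yau constant
`C_LY(β,d) = (c_{β,d} / 2) sup_y ∫ log (Φ_β(y)² / (Φ_β(y+σ) Φ_β(y-σ))) / |σ|^{d+β} dσ`.
It is meaningful when the integrals converge and are bounded above in `y`. -/
def liYauConst (β : ℝ) (d : ℕ) : ℝ :=
  fracConst β d / 2 * ⨆ y : EuclideanSpace ℝ (Fin d), ∫ σ, liYauIntegrand β y σ

end

/-!
The kernel is subordinate to the Gaussian: `exp (-κ ‖ξ‖ ^ β)` is a superposition of Gaussians, since
`x ↦ x ^ (β / 2)` is a Bernstein function. Hence the kernel is a mixture of Gaussians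
`exp (-u ‖y‖²)` and has the form `exp (L (‖y‖²))` with `L` convex on `[0, ∞)`. By the
parallelogram law and convexity,
`L (‖y + σ‖²) + L (‖y - σ‖²) ≥ 2 L (‖y‖² + ‖σ‖²) ≥ 2 L (‖y‖²) + 2 L (‖σ‖²) - 2 L 0`
(`IsGaussianMixture.sq_mul_le`), so the second differences of the logarithm of the kernel are
smallest at the origin, and the supremum in the Li-Yau constant is attained there
(`integral_liYauIntegrand_le`).

The subordinating measure is never constructed. Being a mixture of Gaussians is encoded by a
condition that is stable under sums, averages and pointwise limits (`IsGaussianMixture`), and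
the symbol is reached from `1` by these operations: the Lévy-Khintchine representation
(`levyExponent_rpow`) writes `exp (-κ x ^ α)` as a limit of compound Poisson symbols, whose
exponential series have positive terms (`isMixtureSymbol_exp_neg_rpow`).

The integrals at the origin converge at infinity because the kernel has a polynomial lower
bound, which also gives positivity. It is obtained by keeping only the term of the exponential
series that corresponds to one jump of size about `‖y‖²`; the small jumps hardly distort a
Gaussian of that variance (`le_gaussTransform_of_one_sub_le`, `le_stableKernel`). Near the origin
the second differences of the kernel itself are `O(‖σ‖²)`, because `‖ξ‖² exp (-κ ‖ξ‖ ^ β)` is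
integrable. For the bound at time `t`, self-similarity (`stableKernel_scaling`) reduces to time
`1` at the cost of a factor `1 / t` (`fracLaplacian_comp_smul_add_const`).
-/

open MeasureTheory Filter Topology Real Set

/-! ### Mixtures of centred Gaussians -/

section Mixture

variable {V : Type*} [NormedAddCommGroup V]

/-- `H` lies in the closed convex cone generated by the Gaussians `y ↦ exp (-u ‖y‖²)`, `u > 0`.
The cone is described by duality: a finite combination of point evaluations that is
nonnegative on every Gaussian is nonnegative on `H`. In this form stability under sums,
integrals and pointwise limits is immediate. -/
def IsGaussianMixture (H : V → ℝ) : Prop :=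
  ∀ (n : ℕ) (c : Fin n → ℝ) (y : Fin n → V),
    (∀ u : ℝ, 0 < u → 0 ≤ ∑ i, c i * rexp (-(u * ‖y i‖ ^ 2))) → 0 ≤ ∑ i, c i * H (y i)

namespace IsGaussianMixture

variable {H : V → ℝ}

lemma nonneg (hH : IsGaussianMixture H) (y : V) : 0 ≤ H y := by
  simpa using hH 1 (fun _ => 1) (fun _ => y) (fun u _ => by simp [Real.exp_nonneg])

lemma of_tendsto {ι : Type*} {l : Filter ι} [l.NeBot] {F : ι → V → ℝ}
    (hF : ∀ᶠ k in l, IsGaussianMixture (F k))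
    (hlim : ∀ y, Tendsto (fun k => F k y) l (𝓝 (H y))) : IsGaussianMixture H := by
  intro n c y h
  refine ge_of_tendsto (tendsto_finsetSum _ fun i _ => (hlim (y i)).const_mul (c i)) ?_
  filter_upwards [hF] with k hk using hk n c y h

lemma add {K : V → ℝ} (hH : IsGaussianMixture H) (hK : IsGaussianMixture K) :
    IsGaussianMixture fun y => H y + K y := by
  intro n c y h
  simpa only [mul_add, Finset.sum_add_distrib] using add_nonneg (hH n c y h) (hK n c y h)

lemma const_mul (hH : IsGaussianMixture H) {a : ℝ} (ha : 0 ≤ a) :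
    IsGaussianMixture fun y => a * H y := by
  intro n c y h
  simpa only [mul_left_comm _ a, ← Finset.mul_sum] using mul_nonneg ha (hH n c y h)

/-- A Gaussian mixture is logarithmically convex as a function of the squared norm: this is
the weighted inequality of arithmetic and geometric means on each Gaussian. -/
lemma le_rpow_mul_rpow (hH : IsGaussianMixture H) {y p q : V} (hp : 0 < H p) (hq : 0 < H q)
    {θ : ℝ} (h0 : 0 ≤ θ) (h1 : θ ≤ 1) (h : ‖y‖ ^ 2 = θ * ‖p‖ ^ 2 + (1 - θ) * ‖q‖ ^ 2) :
    H y ≤ H p ^ θ * H q ^ (1 - θ) := by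
  have hG : 0 < H p ^ θ * H q ^ (1 - θ) := by positivity
  have key := hH 3 ![θ / H p, (1 - θ) / H q, -(H p ^ θ * H q ^ (1 - θ))⁻¹] ![p, q, y] ?_
  · simp only [Fin.sum_univ_three, Matrix.cons_val_zero, Matrix.cons_val_one, Matrix.cons_val,
      div_mul_cancel₀ _ hp.ne', div_mul_cancel₀ _ hq.ne'] at key
    have : (H p ^ θ * H q ^ (1 - θ))⁻¹ * H y ≤ 1 := by linarith
    rwa [inv_mul_le_iff₀ hG, mul_one] at this
  · intro u _
    simp only [Fin.sum_univ_three, Matrix.cons_val_zero, Matrix.cons_val_one, Matrix.cons_val]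
    have am := Real.geom_mean_le_arith_mean2_weighted h0 (sub_nonneg.2 h1)
      (p₁ := rexp (-(u * ‖p‖ ^ 2)) / H p) (p₂ := rexp (-(u * ‖q‖ ^ 2)) / H q)
      (by positivity) (by positivity) (by ring)
    rw [Real.div_rpow (by positivity) hp.le, Real.div_rpow (by positivity) hq.le,
      ← Real.exp_mul, ← Real.exp_mul, div_mul_div_comm, ← Real.exp_add] at am
    have e : -(u * ‖p‖ ^ 2) * θ + -(u * ‖q‖ ^ 2) * (1 - θ) = -(u * ‖y‖ ^ 2) := by rw [h]; ring
    rw [e, div_eq_mul_inv] at am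
    have e1 : θ * (rexp (-(u * ‖p‖ ^ 2)) / H p) = θ / H p * rexp (-(u * ‖p‖ ^ 2)) := by ring
    have e2 : (1 - θ) * (rexp (-(u * ‖q‖ ^ 2)) / H q)
      = (1 - θ) / H q * rexp (-(u * ‖q‖ ^ 2)) := by ring
    rw [e1, e2] at am
    linarith

/-- Writing `H y = exp (L (‖y‖²))` with `L` convex, the parallelogram law bounds
`L (‖y + σ‖²) + L (‖y - σ‖²)` below by `2 L (‖y‖² + ‖σ‖²)`, and
`L (a + b) + L 0 ≥ L a + L b` for a convex `L` on `[0, ∞)`. -/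
lemma sq_mul_le {V : Type*} [NormedAddCommGroup V] [InnerProductSpace ℝ V] [Nontrivial V]
    {H : V → ℝ} (hH : IsGaussianMixture H) (hpos : ∀ y, 0 < H y) (y σ : V) :
    (H y * H σ) ^ 2 ≤ H 0 ^ 2 * (H (y + σ) * H (y - σ)) := by
  obtain ⟨c, hc⟩ := exists_norm_eq V (Real.sqrt_nonneg (‖y‖ ^ 2 + ‖σ‖ ^ 2))
  have hc2 : ‖c‖ ^ 2 = ‖y‖ ^ 2 + ‖σ‖ ^ 2 := by rw [hc, Real.sq_sqrt (by positivity)]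
  have hmid : H c ^ 2 ≤ H (y + σ) * H (y - σ) := by
    have h := hH.le_rpow_mul_rpow (y := c) (hpos (y + σ)) (hpos (y - σ)) (θ := 1 / 2)
      (by norm_num) (by norm_num) (by
        have := parallelogram_law_with_norm ℝ y σ
        rw [hc2]; linear_combination (-1 / 2 : ℝ) * this)
    have h2 := pow_le_pow_left₀ (hpos c).le h 2
    rwa [mul_pow, ← Real.rpow_mul_natCast (hpos _).le, ← Real.rpow_mul_natCast (hpos _).le,
      show (1 / 2 : ℝ) * ((2 : ℕ) : ℝ) = 1 by norm_num,
      show (1 - 1 / 2 : ℝ) * ((2 : ℕ) : ℝ) = 1 by norm_num, Real.rpow_one, Real.rpow_one] at h2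
  have hsup : H y * H σ ≤ H 0 * H c := by
    by_cases hz : ‖y‖ ^ 2 + ‖σ‖ ^ 2 = 0
    · have hy : y = 0 := by
        have : ‖y‖ ^ 2 = 0 := by nlinarith [sq_nonneg ‖y‖, sq_nonneg ‖σ‖]
        simpa using this
      have hσ : σ = 0 := by
        have : ‖σ‖ ^ 2 = 0 := by nlinarith [sq_nonneg ‖y‖, sq_nonneg ‖σ‖]
        simpa using this
      have hc' : c = 0 := by simpa [hz] using hc2
      rw [hy, hσ, hc']
    · have hz' : 0 < ‖y‖ ^ 2 + ‖σ‖ ^ 2 := lt_of_le_of_ne (by positivity) (Ne.symm hz)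
      set θ := ‖y‖ ^ 2 / (‖y‖ ^ 2 + ‖σ‖ ^ 2) with hθ
      have hθ0 : 0 ≤ θ := by positivity
      have hθ1 : θ ≤ 1 := by rw [hθ, div_le_one hz']; nlinarith [sq_nonneg ‖σ‖]
      have a := hH.le_rpow_mul_rpow (y := y) (hpos c) (hpos 0) hθ0 hθ1 (by
        rw [hc2, hθ, norm_zero]; field_simp; ring)
      have b := hH.le_rpow_mul_rpow (y := σ) (hpos c) (hpos 0) (sub_nonneg.2 hθ1)
        (by linarith) (by rw [hc2, hθ, norm_zero]; field_simp; ring)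
      have ab := mul_le_mul a b (hpos σ).le (by have := hpos c; have := hpos 0; positivity)
      refine ab.trans (le_of_eq ?_)
      rw [sub_sub_cancel, mul_mul_mul_comm, ← Real.rpow_add (hpos c), ← Real.rpow_add (hpos 0)]
      simp [mul_comm]
  calc (H y * H σ) ^ 2 ≤ (H 0 * H c) ^ 2 :=
        pow_le_pow_left₀ (mul_nonneg (hpos y).le (hpos σ).le) hsup 2
    _ = H 0 ^ 2 * H c ^ 2 := mul_pow _ _ _
    _ ≤ _ := by gcongr

end IsGaussianMixture

end Mixture

/-! ### Multipliers whose transforms are Gaussian mixtures -/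

section Symbol

variable {V : Type*} [NormedAddCommGroup V] [InnerProductSpace ℝ V] [FiniteDimensional ℝ V]
  [MeasurableSpace V] [BorelSpace V]

/-- The inverse Fourier transform, at `y`, of the radial function `ξ ↦ g (‖ξ‖²) exp (-s ‖ξ‖²)`,
written as a cosine integral. -/
noncomputable def gaussTransform (g : ℝ → ℝ) (s : ℝ) (y : V) : ℝ :=
  ∫ ξ : V, Real.cos (2 * π * inner ℝ ξ y) * (g (‖ξ‖ ^ 2) * rexp (-(s * ‖ξ‖ ^ 2)))

lemma integrable_exp_neg_mul_norm_sq {s : ℝ} (hs : 0 < s) :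
    Integrable fun ξ : V => rexp (-(s * ‖ξ‖ ^ 2)) := by
  have h := (GaussianFourier.integrable_cexp_neg_mul_sq_norm_add (V := V) (b := (s : ℂ))
    (by simpa using hs) 0 0).norm
  refine h.congr (Eventually.of_forall fun ξ => ?_)
  simp only [Complex.norm_exp]
  congr 1
  simp [← Complex.ofReal_pow]

lemma gaussTransform_one {s : ℝ} (hs : 0 < s) (y : V) :
    gaussTransform (fun _ => 1) s y
      = (π / s) ^ ((Module.finrank ℝ V : ℝ) / 2) * rexp (-(π ^ 2 / s * ‖y‖ ^ 2)) := by
  have hre : 0 < (s : ℂ).re := by simpa using hs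
  have h := GaussianFourier.integral_cexp_neg_mul_sq_norm_add (V := V) hre
    (2 * π * Complex.I) y
  have hi := GaussianFourier.integrable_cexp_neg_mul_sq_norm_add (V := V) hre
    (2 * π * Complex.I) y
  have h2 := congrArg Complex.re h
  rw [← RCLike.re_eq_complex_re, ← integral_re hi] at h2
  have e1 : ∀ ξ : V, RCLike.re (Complex.exp (-(s : ℂ) * (‖ξ‖ : ℂ) ^ 2
      + 2 * π * Complex.I * (inner ℝ y ξ : ℝ)))
      = Real.cos (2 * π * inner ℝ ξ y) * (1 * rexp (-(s * ‖ξ‖ ^ 2))) := by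
    intro ξ
    rw [RCLike.re_eq_complex_re, Complex.exp_re, real_inner_comm]
    simp [← Complex.ofReal_pow, mul_comm]
  simp only [e1] at h2
  rw [gaussTransform, h2, RCLike.re_eq_complex_re]
  have e2 : ((π : ℂ) / s) ^ ((Module.finrank ℝ V : ℂ) / 2)
      = (((π / s) ^ ((Module.finrank ℝ V : ℝ) / 2) : ℝ) : ℂ) := by
    rw [Complex.ofReal_cpow (by positivity)]; push_cast; rfl
  have e3 : Complex.exp ((2 * π * Complex.I) ^ 2 * (‖y‖ : ℂ) ^ 2 / (4 * s))
      = ((rexp (-(π ^ 2 / s * ‖y‖ ^ 2)) : ℝ) : ℂ) := by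
    rw [Complex.ofReal_exp]
    congr 1
    push_cast
    have : (s : ℂ) ≠ 0 := by exact_mod_cast hs.ne'
    field_simp
    rw [Complex.I_sq]; ring
  rw [e2, e3, ← Complex.ofReal_mul, Complex.ofReal_re]

lemma integrable_gaussTransform {g : ℝ → ℝ} (hg : Measurable g) {C : ℝ}
    (hC : ∀ x, 0 ≤ x → |g x| ≤ C) {s : ℝ} (hs : 0 < s) (y : V) :
    Integrable fun ξ : V =>
      Real.cos (2 * π * inner ℝ ξ y) * (g (‖ξ‖ ^ 2) * rexp (-(s * ‖ξ‖ ^ 2))) := by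
  refine ((integrable_exp_neg_mul_norm_sq (V := V) hs).const_mul C).mono' ?_ ?_
  · have : Measurable fun ξ : V => g (‖ξ‖ ^ 2) := hg.comp (by fun_prop)
    have h2 : Measurable fun ξ : V => Real.cos (2 * π * inner ℝ ξ y) :=
      Continuous.measurable (by fun_prop)
    exact (h2.mul (this.mul (by fun_prop))).aestronglyMeasurable
  · refine Eventually.of_forall fun ξ => ?_
    rw [norm_mul, norm_mul, Real.norm_eq_abs, Real.norm_eq_abs, Real.norm_eq_abs,
      Real.abs_exp]
    calc _ ≤ 1 * (C * rexp (-(s * ‖ξ‖ ^ 2))) := by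
          gcongr
          · exact Real.abs_cos_le_one _
          · exact hC _ (by positivity)
      _ = _ := one_mul _

variable (V) in
/-- A bounded multiplier `g` of `‖ξ‖²` such that, after any Gaussian regularization, the inverse
Fourier transform on `V` is a Gaussian mixture. The model case is the Laplace transform of a
finite measure on `[0, ∞)`; the regularization makes every integral converge absolutely. -/
structure IsMixtureSymbol (g : ℝ → ℝ) : Prop where
  measurable : Measurable g
  bounded : ∃ C, ∀ x, 0 ≤ x → |g x| ≤ C
  mixture : ∀ s, 0 < s → IsGaussianMixture (gaussTransform (V := V) g s)

namespace IsMixtureSymbol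

variable {g : ℝ → ℝ}

lemma one : IsMixtureSymbol V fun _ => 1 := by
  refine ⟨measurable_const, ⟨1, by simp⟩, fun s hs n c y h => ?_⟩
  have h1 := mul_nonneg (show (0 : ℝ) ≤ (π / s) ^ ((Module.finrank ℝ V : ℝ) / 2) by positivity)
    (h (π ^ 2 / s) (by positivity))
  simp only [gaussTransform_one hs]
  simpa only [Finset.mul_sum, mul_left_comm] using h1

lemma add {h : ℝ → ℝ} (hg : IsMixtureSymbol V g) (hh : IsMixtureSymbol V h) :
    IsMixtureSymbol V fun x => g x + h x := by
  obtain ⟨C, hC⟩ := hg.bounded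
  obtain ⟨D, hD⟩ := hh.bounded
  refine ⟨hg.measurable.add hh.measurable, ⟨C + D, fun x hx =>
    (abs_add_le _ _).trans (add_le_add (hC x hx) (hD x hx))⟩, fun s hs => ?_⟩
  have : gaussTransform (V := V) (fun x => g x + h x) s
      = fun y => gaussTransform g s y + gaussTransform h s y := by
    funext y
    rw [gaussTransform, gaussTransform, gaussTransform,
      ← integral_add (integrable_gaussTransform hg.measurable hC hs y)
        (integrable_gaussTransform hh.measurable hD hs y)]
    congr 1; funext ξ; ring
  rw [this]
  exact (hg.mixture s hs).add (hh.mixture s hs)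

lemma const_mul (hg : IsMixtureSymbol V g) {a : ℝ} (ha : 0 ≤ a) :
    IsMixtureSymbol V fun x => a * g x := by
  obtain ⟨C, hC⟩ := hg.bounded
  refine ⟨hg.measurable.const_mul a, ⟨a * C, fun x hx => ?_⟩, fun s hs => ?_⟩
  · rw [abs_mul, abs_of_nonneg ha]
    exact mul_le_mul_of_nonneg_left (hC x hx) ha
  · have : gaussTransform (V := V) (fun x => a * g x) s
        = fun y => a * gaussTransform g s y := by
      funext y
      rw [gaussTransform, gaussTransform, ← integral_const_mul]
      congr 1; funext ξ; ring
    rw [this]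
    exact (hg.mixture s hs).const_mul ha

lemma of_tendsto {f : ℕ → ℝ → ℝ} (hf : ∀ n, IsMixtureSymbol V (f n)) (hg : Measurable g)
    {C : ℝ} (hC : ∀ n x, 0 ≤ x → |f n x| ≤ C)
    (hlim : ∀ x, 0 ≤ x → Tendsto (fun n => f n x) atTop (𝓝 (g x))) :
    IsMixtureSymbol V g := by
  refine ⟨hg, ⟨C, fun x hx => le_of_tendsto' (hlim x hx).abs fun n => hC n x hx⟩,
    fun s hs => ?_⟩
  refine IsGaussianMixture.of_tendsto (l := atTop)
    (Eventually.of_forall fun n => (hf n).mixture s hs) fun y => ?_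
  refine tendsto_integral_of_dominated_convergence
    (fun ξ : V => C * rexp (-(s * ‖ξ‖ ^ 2)))
    (fun n => (integrable_gaussTransform (hf n).measurable (hC n) hs y).1)
    ((integrable_exp_neg_mul_norm_sq hs).const_mul C) (fun n => Eventually.of_forall fun ξ => ?_)
    (Eventually.of_forall fun ξ => ?_)
  · rw [norm_mul, norm_mul, Real.norm_eq_abs, Real.norm_eq_abs, Real.norm_eq_abs, Real.abs_exp]
    calc _ ≤ 1 * (C * rexp (-(s * ‖ξ‖ ^ 2))) := by
          gcongr
          · exact Real.abs_cos_le_one _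
          · exact hC n _ (by positivity)
      _ = _ := one_mul _
  · exact ((hlim _ (by positivity)).mul_const _).const_mul _

end IsMixtureSymbol

/-- The Laplace transform of the measure with density `w` on `A`. -/
noncomputable def laplaceOn (A : Set ℝ) (w : ℝ → ℝ) (x : ℝ) : ℝ :=
  ∫ r in A, w r * rexp (-(x * r))

section Laplace

variable {A : Set ℝ} {w : ℝ → ℝ}

lemma measurable_laplaceOn (hw : Measurable w) : Measurable (laplaceOn A w) := by
  have : Measurable fun p : ℝ × ℝ => w p.2 * rexp (-(p.1 * p.2)) :=
    (hw.comp measurable_snd).mul (by fun_prop)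
  exact (this.stronglyMeasurable.integral_prod_right' (ν := volume.restrict A)).measurable

lemma integrableOn_laplace (hA : MeasurableSet A) (hA0 : A ⊆ Ioi 0) (hw : Measurable w)
    (hwi : IntegrableOn w A) {x : ℝ} (hx : 0 ≤ x) :
    IntegrableOn (fun r => w r * rexp (-(x * r))) A := by
  refine hwi.norm.mono' (hw.mul (by fun_prop)).aestronglyMeasurable ?_
  filter_upwards [ae_restrict_mem hA] with r hr
  rw [norm_mul, Real.norm_eq_abs (rexp _), Real.abs_exp]
  refine mul_le_of_le_one_right (norm_nonneg _) (Real.exp_le_one_iff.2 ?_)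
  have := mul_nonneg hx (le_of_lt (hA0 hr))
  linarith

lemma laplaceOn_nonneg (hA : MeasurableSet A) (hw0 : ∀ r ∈ A, 0 ≤ w r) (x : ℝ) :
    0 ≤ laplaceOn A w x :=
  setIntegral_nonneg hA fun r hr => mul_nonneg (hw0 r hr) (Real.exp_nonneg _)

lemma laplaceOn_le (hA : MeasurableSet A) (hA0 : A ⊆ Ioi 0) (hw : Measurable w)
    (hwi : IntegrableOn w A) (hw0 : ∀ r ∈ A, 0 ≤ w r) {x : ℝ} (hx : 0 ≤ x) :
    laplaceOn A w x ≤ ∫ r in A, w r := by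
  refine setIntegral_mono_on (integrableOn_laplace hA hA0 hw hwi hx) hwi hA fun r hr => ?_
  refine mul_le_of_le_one_right (hw0 r hr) (Real.exp_le_one_iff.2 ?_)
  have := mul_nonneg hx (le_of_lt (hA0 hr))
  linarith

/-- Multiplying by a Laplace transform averages the Gaussian regularization parameter. -/
lemma gaussTransform_mul_laplaceOn {g : ℝ → ℝ} (hg : Measurable g) {C : ℝ}
    (hC : ∀ x, 0 ≤ x → |g x| ≤ C) (hA : MeasurableSet A) (hA0 : A ⊆ Ioi 0)
    (hw : Measurable w) (hwi : IntegrableOn w A) {s : ℝ} (hs : 0 < s) (y : V) :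
    IntegrableOn (fun r => w r * gaussTransform g (s + r) y) A ∧
    gaussTransform (fun x => g x * laplaceOn A w x) s y
      = ∫ r in A, w r * gaussTransform g (s + r) y := by
  set F : V → ℝ → ℝ := fun ξ r =>
    w r * (Real.cos (2 * π * inner ℝ ξ y) * (g (‖ξ‖ ^ 2) * rexp (-((s + r) * ‖ξ‖ ^ 2)))) with hF
  have hC0 : 0 ≤ C := (abs_nonneg _).trans (hC 0 le_rfl)
  have hint : Integrable (Function.uncurry F) (volume.prod (volume.restrict A)) := by
    refine (((integrable_exp_neg_mul_norm_sq (V := V) hs).const_mul C).mul_prod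
      (hwi.norm)).mono' ?_ ?_
    · have m1 : Measurable fun p : V × ℝ => w p.2 := hw.comp measurable_snd
      have m2 : Measurable fun p : V × ℝ => g (‖p.1‖ ^ 2) := hg.comp (by fun_prop)
      have m3 : Measurable fun p : V × ℝ => Real.cos (2 * π * inner ℝ p.1 y) := by
        have : Measurable fun ξ : V => Real.cos (2 * π * inner ℝ ξ y) :=
          Continuous.measurable (by fun_prop)
        exact this.comp measurable_fst
      exact (m1.mul (m3.mul (m2.mul (by fun_prop)))).aestronglyMeasurable
    · have hae : ∀ᵐ p : V × ℝ ∂(volume.prod (volume.restrict A)), p.2 ∈ A :=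
        Measure.quasiMeasurePreserving_snd.ae (ae_restrict_mem hA)
      filter_upwards [hae] with p hp
      have hr : 0 < p.2 := hA0 hp
      simp only [Function.uncurry, hF, norm_mul, Real.norm_eq_abs, Real.abs_exp]
      calc |w p.2| * (|Real.cos (2 * π * inner ℝ p.1 y)|
            * (|g (‖p.1‖ ^ 2)| * rexp (-((s + p.2) * ‖p.1‖ ^ 2))))
          ≤ |w p.2| * (1 * (C * rexp (-(s * ‖p.1‖ ^ 2)))) := by
            gcongr
            · exact Real.abs_cos_le_one _
            · exact hC _ (by positivity)
            · linarith
        _ = _ := by ring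
  have e1 : ∀ r, ∫ ξ : V, F ξ r = w r * gaussTransform g (s + r) y := fun r => by
    simp only [hF, gaussTransform, integral_const_mul]
  constructor
  · exact hint.integral_prod_right.congr (Eventually.of_forall e1)
  · have hsw := integral_integral_swap hint
    simp only [e1] at hsw
    rw [← hsw, gaussTransform]
    congr 1; funext ξ
    simp only [hF, laplaceOn]
    rw [mul_right_comm (g _), ← mul_assoc (Real.cos _), ← integral_const_mul]
    congr 1; funext r
    rw [add_mul, neg_add, Real.exp_add, mul_comm (‖ξ‖ ^ 2) r]
    ring

lemma IsMixtureSymbol.mul_laplaceOn {g : ℝ → ℝ} (hg : IsMixtureSymbol V g)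
    (hA : MeasurableSet A) (hA0 : A ⊆ Ioi 0) (hw : Measurable w) (hwi : IntegrableOn w A)
    (hw0 : ∀ r ∈ A, 0 ≤ w r) : IsMixtureSymbol V fun x => g x * laplaceOn A w x := by
  obtain ⟨C, hC⟩ := hg.bounded
  refine ⟨hg.measurable.mul (measurable_laplaceOn hw), ⟨C * ∫ r in A, w r, fun x hx => ?_⟩,
    fun s hs n c y h => ?_⟩
  · rw [abs_mul, abs_of_nonneg (laplaceOn_nonneg hA hw0 x)]
    exact mul_le_mul (hC x hx) (laplaceOn_le hA hA0 hw hwi hw0 hx) (laplaceOn_nonneg hA hw0 x)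
      ((abs_nonneg _).trans (hC x hx))
  · have key := fun i => gaussTransform_mul_laplaceOn hg.measurable hC hA hA0 hw hwi hs (y i)
    simp only [(key _).2, ← integral_const_mul]
    rw [← integral_finsetSum _ fun i _ => (key i).1.const_mul (c i)]
    refine setIntegral_nonneg hA fun r hr => ?_
    simp only [mul_left_comm _ (w r), ← Finset.mul_sum]
    exact mul_nonneg (hw0 r hr) (hg.mixture (s + r) (add_pos hs (hA0 hr)) n c y h)

/-- Closure under power series with nonnegative coefficients in a Laplace transform. -/
lemma IsMixtureSymbol.mul_hasSum {g : ℝ → ℝ} (hg : IsMixtureSymbol V g)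
    (hA : MeasurableSet A) (hA0 : A ⊆ Ioi 0) (hw : Measurable w) (hwi : IntegrableOn w A)
    (hw0 : ∀ r ∈ A, 0 ≤ w r) {a : ℕ → ℝ} (ha : ∀ k, 0 ≤ a k) {h : ℝ → ℝ} (hh : Measurable h)
    {D : ℝ} (hD : ∀ x, 0 ≤ x → h x ≤ D)
    (hsum : ∀ x, 0 ≤ x → HasSum (fun k => a k * laplaceOn A w x ^ k) (h x)) :
    IsMixtureSymbol V fun x => g x * h x := by
  obtain ⟨C, hC⟩ := hg.bounded
  have hpow : ∀ k : ℕ, IsMixtureSymbol V fun x => g x * laplaceOn A w x ^ k := by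
    intro k
    induction k with
    | zero => simpa using hg
    | succ k ih => simpa only [pow_succ, mul_assoc] using ih.mul_laplaceOn hA hA0 hw hwi hw0
  have hpart : ∀ n : ℕ, IsMixtureSymbol V
      fun x => g x * ∑ k ∈ Finset.range n, a k * laplaceOn A w x ^ k := by
    intro n
    induction n with
    | zero => simpa using hg.const_mul le_rfl
    | succ n ih =>
      have := ih.add ((hpow n).const_mul (ha n))
      simpa only [Finset.sum_range_succ, mul_add, mul_left_comm] using this
  have hterm : ∀ x k, 0 ≤ a k * laplaceOn A w x ^ k := fun x k =>
    mul_nonneg (ha k) (pow_nonneg (laplaceOn_nonneg hA hw0 x) k)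
  refine IsMixtureSymbol.of_tendsto hpart (hg.measurable.mul hh) (C := C * D)
    (fun n x hx => ?_) fun x hx => (hsum x hx).tendsto_sum_nat.const_mul _
  rw [abs_mul, abs_of_nonneg (Finset.sum_nonneg fun k _ => hterm x k)]
  exact mul_le_mul (hC x hx)
    ((sum_le_hasSum _ (fun k _ => hterm x k) (hsum x hx)).trans (hD x hx))
    (Finset.sum_nonneg fun k _ => hterm x k) ((abs_nonneg _).trans (hC x hx))

end Laplace

end Symbol

/-! ### The symbol `exp (-κ x ^ α)` -/

section Stable

lemma one_sub_exp_neg_nonneg {x : ℝ} (hx : 0 ≤ x) : 0 ≤ 1 - rexp (-x) :=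
  sub_nonneg.2 (Real.exp_le_one_iff.2 (neg_nonpos.2 hx))

lemma one_sub_exp_neg_le (x : ℝ) : 1 - rexp (-x) ≤ x := by
  linarith [Real.add_one_le_exp (-x)]

/-- The Lévy exponent of the jump density `w` on `A`. -/
noncomputable def levyExponent (A : Set ℝ) (w : ℝ → ℝ) (x : ℝ) : ℝ :=
  ∫ r in A, (1 - rexp (-(x * r))) * w r

variable {A : Set ℝ} {w : ℝ → ℝ}

lemma measurable_levyExponent (hw : Measurable w) : Measurable (levyExponent A w) := by
  have : Measurable fun p : ℝ × ℝ => (1 - rexp (-(p.1 * p.2))) * w p.2 :=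
    Measurable.mul (by fun_prop) (hw.comp measurable_snd)
  exact (this.stronglyMeasurable.integral_prod_right' (ν := volume.restrict A)).measurable

lemma levyExponent_nonneg (hA : MeasurableSet A) (hA0 : A ⊆ Ioi 0) (hw0 : ∀ r ∈ A, 0 ≤ w r)
    {x : ℝ} (hx : 0 ≤ x) : 0 ≤ levyExponent A w x :=
  setIntegral_nonneg hA fun r hr =>
    mul_nonneg (one_sub_exp_neg_nonneg (mul_nonneg hx (le_of_lt (hA0 hr)))) (hw0 r hr)

lemma levyExponent_eq (hA : MeasurableSet A) (hA0 : A ⊆ Ioi 0) (hw : Measurable w)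
    (hwi : IntegrableOn w A) {x : ℝ} (hx : 0 ≤ x) :
    levyExponent A w x = (∫ r in A, w r) - laplaceOn A w x := by
  rw [laplaceOn, ← integral_sub hwi (integrableOn_laplace hA hA0 hw hwi hx), levyExponent]
  congr 1; funext r; ring

lemma integrableOn_levy (hA : MeasurableSet A) (hA0 : A ⊆ Ioi 0) (hw : Measurable w)
    (hw0 : ∀ r ∈ A, 0 ≤ w r) (hwi : IntegrableOn (fun r => r * w r) A) {x : ℝ} (hx : 0 ≤ x) :
    IntegrableOn (fun r => (1 - rexp (-(x * r))) * w r) A := by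
  refine (hwi.const_mul x).mono' (Measurable.mul (by fun_prop) hw).aestronglyMeasurable ?_
  filter_upwards [ae_restrict_mem hA] with r hr
  have h1 := one_sub_exp_neg_nonneg (mul_nonneg hx (le_of_lt (hA0 hr)))
  rw [Real.norm_eq_abs, abs_of_nonneg (mul_nonneg h1 (hw0 r hr)), ← mul_assoc]
  exact mul_le_mul_of_nonneg_right (one_sub_exp_neg_le _) (hw0 r hr)

lemma levyExponent_le (hA : MeasurableSet A) (hA0 : A ⊆ Ioi 0) (hw : Measurable w)
    (hw0 : ∀ r ∈ A, 0 ≤ w r) (hwi : IntegrableOn (fun r => r * w r) A) {x : ℝ} (hx : 0 ≤ x) :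
    levyExponent A w x ≤ (∫ r in A, r * w r) * x := by
  rw [mul_comm, ← integral_const_mul]
  refine setIntegral_mono_on (integrableOn_levy hA hA0 hw hw0 hwi hx) (hwi.const_mul x) hA
    fun r hr => ?_
  rw [← mul_assoc]
  exact mul_le_mul_of_nonneg_right (one_sub_exp_neg_le _) (hw0 r hr)

variable {V : Type*} [NormedAddCommGroup V] [InnerProductSpace ℝ V] [FiniteDimensional ℝ V]
  [MeasurableSpace V] [BorelSpace V]

/-- The symbol of a compound Poisson law is a mixture symbol. -/
lemma IsMixtureSymbol.mul_exp_laplaceOn {g : ℝ → ℝ} (hg : IsMixtureSymbol V g)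
    (hA : MeasurableSet A) (hA0 : A ⊆ Ioi 0) (hw : Measurable w) (hwi : IntegrableOn w A)
    (hw0 : ∀ r ∈ A, 0 ≤ w r) :
    IsMixtureSymbol V fun x => g x * rexp (laplaceOn A w x) := by
  refine hg.mul_hasSum hA hA0 hw hwi hw0 (a := fun k => ((k.factorial : ℝ))⁻¹)
    (fun k => by positivity) (measurable_laplaceOn hw).exp (D := rexp (∫ r in A, w r))
    (fun x hx => Real.exp_le_exp.2 (laplaceOn_le hA hA0 hw hwi hw0 hx)) fun x _ => ?_
  have := NormedSpace.expSeries_div_hasSum_exp (laplaceOn A w x)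
  rw [← Real.exp_eq_exp_ℝ] at this
  simpa only [div_eq_inv_mul] using this

/-- Removing the linear term of the exponential series leaves a mixture symbol. -/
lemma IsMixtureSymbol.mul_exp_laplaceOn_sub {g : ℝ → ℝ} (hg : IsMixtureSymbol V g)
    (hA : MeasurableSet A) (hA0 : A ⊆ Ioi 0) (hw : Measurable w) (hwi : IntegrableOn w A)
    (hw0 : ∀ r ∈ A, 0 ≤ w r) :
    IsMixtureSymbol V fun x => g x * (rexp (laplaceOn A w x) - laplaceOn A w x) := by
  refine hg.mul_hasSum hA hA0 hw hwi hw0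
    (a := fun k => ((k.factorial : ℝ))⁻¹ - if k = 1 then 1 else 0)
    (fun k => ?_) ((measurable_laplaceOn hw).exp.sub (measurable_laplaceOn hw))
    (D := rexp (∫ r in A, w r))
    (fun x hx => (sub_le_self _ (laplaceOn_nonneg hA hw0 x)).trans
      (Real.exp_le_exp.2 (laplaceOn_le hA hA0 hw hwi hw0 hx))) fun x _ => ?_
  · by_cases hk : k = 1
    · simp [hk]
    · simp only [hk, if_false, sub_zero]; positivity
  · have := NormedSpace.expSeries_div_hasSum_exp (laplaceOn A w x)
    rw [← Real.exp_eq_exp_ℝ] at this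
    have h2 := this.sub (hasSum_ite_eq 1 (laplaceOn A w x))
    refine h2.congr_fun fun k => ?_
    by_cases hk : k = 1
    · simp [hk]
    · simp [hk, div_eq_inv_mul]

/-- Infinitely many small jumps are the limit of finitely many. -/
lemma isMixtureSymbol_exp_neg_levyExponent (hw : Measurable w) (hw0 : ∀ r, 0 < r → 0 ≤ w r)
    (hwi : IntegrableOn (fun r => r * w r) (Ioc 0 1)) :
    IsMixtureSymbol V fun x => rexp (-levyExponent (Ioc 0 1) w x) := by
  set A : ℕ → Set ℝ := fun n => Ioc (1 / ((n : ℝ) + 1)) 1 with hAdef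
  have hpos : ∀ n : ℕ, (0 : ℝ) < 1 / ((n : ℝ) + 1) := fun n => by positivity
  have hA0 : ∀ n, A n ⊆ Ioi 0 := fun n r hr => (hpos n).trans hr.1
  have hA1 : ∀ n, A n ⊆ Ioc 0 1 := fun n r hr => ⟨(hpos n).trans hr.1, hr.2⟩
  have hAm : ∀ n, MeasurableSet (A n) := fun n => measurableSet_Ioc
  have hwA : ∀ n, IntegrableOn w (A n) := by
    intro n
    refine ((hwi.mono_set (hA1 n)).const_mul ((n : ℝ) + 1)).mono' hw.aestronglyMeasurable ?_
    filter_upwards [ae_restrict_mem (hAm n)] with r hr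
    have h0 := hw0 r (hA0 n hr)
    rw [Real.norm_eq_abs, abs_of_nonneg h0, ← mul_assoc]
    refine le_mul_of_one_le_left h0 ?_
    have := hr.1
    rw [div_lt_iff₀ (by positivity)] at this
    linarith
  have hU : ⋃ n, A n = Ioc 0 1 := by
    refine Subset.antisymm (iUnion_subset hA1) fun r hr => ?_
    obtain ⟨n, hn⟩ := exists_nat_one_div_lt hr.1
    exact mem_iUnion.2 ⟨n, hn, hr.2⟩
  refine IsMixtureSymbol.of_tendsto
    (f := fun n x => rexp (-∫ r in A n, w r) * (1 * rexp (laplaceOn (A n) w x)))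
    (fun n => (IsMixtureSymbol.one.mul_exp_laplaceOn (hAm n) (hA0 n) hw (hwA n)
      fun r hr => hw0 r (hA0 n hr)).const_mul (Real.exp_nonneg _))
    (measurable_levyExponent hw).neg.exp (C := 1) (fun n x hx => ?_) fun x hx => ?_
  · rw [one_mul, ← Real.exp_add, Real.abs_exp, Real.exp_le_one_iff]
    have := laplaceOn_le (hAm n) (hA0 n) hw (hwA n) (fun r hr => hw0 r (hA0 n hr)) hx
    linarith
  · have hlim := tendsto_setIntegral_of_monotone (μ := volume)
      (f := fun r => (1 - rexp (-(x * r))) * w r) hAm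
      (fun m n hmn => Ioc_subset_Ioc_left (by gcongr)) (by
        rw [hU]
        exact integrableOn_levy measurableSet_Ioc (fun r hr => hr.1) hw
          (fun r hr => hw0 r hr.1) hwi hx)
    rw [hU] at hlim
    refine (hlim.neg.rexp).congr fun n => ?_
    change rexp (-levyExponent (A n) w x) = _
    rw [levyExponent_eq (hAm n) (hA0 n) hw (hwA n) hx, one_mul, ← Real.exp_add]
    congr 1; ring

/-- A multiplier close to `1` near the origin leaves a wide Gaussian comparable to itself
within its standard deviation. -/
lemma le_gaussTransform_of_one_sub_le {g : ℝ → ℝ} (hg : Measurable g)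
    (hg1 : ∀ x, 0 ≤ x → |g x| ≤ 1) {C : ℝ} (hC : ∀ x, 0 ≤ x → 1 - g x ≤ C * x) :
    ∃ S₀ : ℝ, 1 ≤ S₀ ∧ ∀ s, S₀ ≤ s → ∀ y : V, ‖y‖ ^ 2 ≤ s →
      rexp (-π ^ 2) / 2 * (π / s) ^ ((Module.finrank ℝ V : ℝ) / 2) ≤ gaussTransform g s y := by
  have hC0 : 0 ≤ C := by
    have h1 := hC 1 zero_le_one
    have h2 := (abs_le.1 (hg1 1 zero_le_one)).2
    linarith
  set p := (Module.finrank ℝ V : ℝ) / 2 with hp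
  refine ⟨4 * C * 2 ^ p * rexp (π ^ 2) + 1, by
    have : 0 ≤ 4 * C * 2 ^ p * rexp (π ^ 2) := by positivity
    linarith, fun s hs y hy => ?_⟩
  have hs0 : 0 < s := by
    have : 0 ≤ 4 * C * 2 ^ p * rexp (π ^ 2) := by positivity
    linarith
  have i1 := integrable_gaussTransform (V := V) (g := fun _ => 1) measurable_const (C := 1)
    (by simp) hs0 y
  have i2 := integrable_gaussTransform (V := V) hg hg1 hs0 y
  have hdiff : gaussTransform (fun _ => 1) s y - gaussTransform g s y
      ≤ ∫ ξ : V, 2 * C / s * rexp (-(s / 2 * ‖ξ‖ ^ 2)) := by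
    rw [gaussTransform, gaussTransform, ← integral_sub i1 i2]
    refine integral_mono (i1.sub i2)
      ((integrable_exp_neg_mul_norm_sq (half_pos hs0)).const_mul _) fun ξ => ?_
    have hx : 0 ≤ ‖ξ‖ ^ 2 := by positivity
    have hg0 : 0 ≤ 1 - g (‖ξ‖ ^ 2) := sub_nonneg.2 (abs_le.1 (hg1 _ hx)).2
    have hexp : s / 2 * ‖ξ‖ ^ 2 ≤ rexp (s / 2 * ‖ξ‖ ^ 2) := by
      linarith [Real.add_one_le_exp (s / 2 * ‖ξ‖ ^ 2)]
    calc Real.cos (2 * π * inner ℝ ξ y) * (1 * rexp (-(s * ‖ξ‖ ^ 2)))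
          - Real.cos (2 * π * inner ℝ ξ y) * (g (‖ξ‖ ^ 2) * rexp (-(s * ‖ξ‖ ^ 2)))
        = Real.cos (2 * π * inner ℝ ξ y) * ((1 - g (‖ξ‖ ^ 2)) * rexp (-(s * ‖ξ‖ ^ 2))) := by
          ring
      _ ≤ 1 * (C * ‖ξ‖ ^ 2 * rexp (-(s * ‖ξ‖ ^ 2))) := by
          gcongr
          · exact Real.cos_le_one _
          · exact hC _ hx
      _ = 2 * C / s * ((s / 2 * ‖ξ‖ ^ 2) * rexp (-(s * ‖ξ‖ ^ 2))) := by field_simp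
      _ ≤ 2 * C / s * (rexp (s / 2 * ‖ξ‖ ^ 2) * rexp (-(s * ‖ξ‖ ^ 2))) := by gcongr
      _ = 2 * C / s * rexp (-(s / 2 * ‖ξ‖ ^ 2)) := by
          rw [← Real.exp_add]; congr 2; ring
  have hI : ∫ ξ : V, rexp (-(s / 2 * ‖ξ‖ ^ 2)) = 2 ^ p * (π / s) ^ p := by
    have := gaussTransform_one (V := V) (half_pos hs0) 0
    rw [gaussTransform] at this
    simp only [inner_zero_right, mul_zero, Real.cos_zero, one_mul, norm_zero, ne_eq,
      OfNat.ofNat_ne_zero, not_false_eq_true, zero_pow, neg_zero, Real.exp_zero, mul_one] at this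
    rw [this, ← Real.mul_rpow (by norm_num) (by positivity)]
    congr 1; field_simp
  rw [integral_const_mul, hI, gaussTransform_one hs0 y] at hdiff
  have hmain : rexp (-π ^ 2) ≤ rexp (-(π ^ 2 / s * ‖y‖ ^ 2)) := by
    refine Real.exp_le_exp.2 (neg_le_neg ?_)
    rw [div_mul_eq_mul_div, div_le_iff₀ hs0]
    gcongr
  have hsmall : 2 * C / s * 2 ^ p ≤ rexp (-π ^ 2) / 2 := by
    rw [div_mul_eq_mul_div, div_le_iff₀ hs0]
    have hee : rexp (-π ^ 2) * rexp (π ^ 2) = 1 := by rw [← Real.exp_add]; simp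
    calc 2 * C * 2 ^ p = rexp (-π ^ 2) / 2 * (4 * C * 2 ^ p * rexp (π ^ 2)) := by
          linear_combination (-2 * C * 2 ^ p) * hee
      _ ≤ _ := by gcongr; linarith
  have hps : 0 ≤ (π / s) ^ p := by positivity
  nlinarith [mul_le_mul_of_nonneg_left hmain hps, mul_le_mul_of_nonneg_left hsmall hps]

/-- The constant `∫₀^∞ (1 - e^{-r}) r^{-1-α} dr`. -/
noncomputable def stableIntegral (α : ℝ) : ℝ :=
  ∫ r in Ioi (0 : ℝ), (1 - rexp (-r)) * r ^ (-1 - α)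

variable {α : ℝ}

lemma integrableOn_mul_rpow (hα : α < 1) :
    IntegrableOn (fun r : ℝ => r * r ^ (-1 - α)) (Ioc 0 1) := by
  have h := (intervalIntegral.integrableOn_Ioo_rpow_iff (s := -α) zero_lt_one).2 (by linarith)
  rw [← integrableOn_Ioc_iff_integrableOn_Ioo] at h
  refine h.congr_fun (fun r hr => ?_) measurableSet_Ioc
  simp only
  rw [show -α = 1 + (-1 - α) by ring, Real.rpow_add hr.1, Real.rpow_one]

lemma integrableOn_levy_rpow (hα0 : 0 < α) (hα : α < 1) {x : ℝ} (hx : 0 ≤ x) :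
    IntegrableOn (fun r : ℝ => (1 - rexp (-(x * r))) * r ^ (-1 - α)) (Ioi 0) := by
  rw [← Ioc_union_Ioi_eq_Ioi (zero_le_one' ℝ)]
  refine IntegrableOn.union (integrableOn_levy measurableSet_Ioc (fun r hr => hr.1) (by fun_prop)
    (fun r hr => Real.rpow_nonneg hr.1.le _) (integrableOn_mul_rpow hα) hx) ?_
  refine (integrableOn_Ioi_rpow_of_lt (by linarith : -1 - α < -1) zero_lt_one).mono'
    (Measurable.aestronglyMeasurable (by fun_prop)) ?_
  filter_upwards [ae_restrict_mem measurableSet_Ioi] with r hr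
  have hr0 : (0 : ℝ) < r := zero_lt_one.trans hr
  have h1 := one_sub_exp_neg_nonneg (mul_nonneg hx hr0.le)
  rw [Real.norm_eq_abs, abs_of_nonneg (mul_nonneg h1 (by positivity))]
  exact mul_le_of_le_one_left (by positivity) (sub_le_self _ (Real.exp_nonneg _))

lemma stableIntegral_pos (hα0 : 0 < α) (hα : α < 1) : 0 < stableIntegral α := by
  have hi := integrableOn_levy_rpow hα0 hα zero_le_one
  simp only [one_mul] at hi
  rw [stableIntegral, setIntegral_pos_iff_support_of_nonneg_ae _ hi]
  · have : Ioi (0 : ℝ) ⊆ Function.support (fun r : ℝ => (1 - rexp (-r)) * r ^ (-1 - α)) := by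
      intro r (hr : 0 < r)
      have : rexp (-r) < 1 := by simpa using hr
      exact (mul_pos (sub_pos.2 this) (Real.rpow_pos_of_pos hr _)).ne'
    rw [inter_eq_right.2 this]
    simp
  · filter_upwards [ae_restrict_mem measurableSet_Ioi] with r hr
    exact mul_nonneg (one_sub_exp_neg_nonneg (le_of_lt hr)) (Real.rpow_nonneg (le_of_lt hr) _)

/-- The Lévy-Khintchine representation of `x ↦ x ^ α`, by scaling. -/
lemma levyExponent_rpow (hα0 : 0 < α) {x : ℝ} (hx : 0 ≤ x) :
    levyExponent (Ioi 0) (fun r => r ^ (-1 - α)) x = x ^ α * stableIntegral α := by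
  rcases hx.eq_or_lt with rfl | hx
  · simp [levyExponent, Real.zero_rpow hα0.ne']
  · have h := integral_comp_mul_left_Ioi (fun r : ℝ => (1 - rexp (-r)) * r ^ (-1 - α)) 0 hx
    rw [mul_zero, smul_eq_mul] at h
    rw [stableIntegral, ← mul_inv_cancel_left₀ hx.ne' (∫ r in Ioi (0 : ℝ), _), ← h, levyExponent,
      ← mul_assoc, ← integral_const_mul]
    refine setIntegral_congr_fun measurableSet_Ioi fun r (hr : 0 < r) => ?_
    rw [Real.mul_rpow hx.le hr.le]
    have : x ^ α * x * x ^ (-1 - α) = 1 := by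
      rw [← Real.rpow_add_one hx.ne', ← Real.rpow_add hx]
      ring_nf; simp
    linear_combination (-(1 - rexp (-(x * r))) * r ^ (-1 - α)) * this

/-- The symbol `exp (-κ x ^ α)` is a mixture symbol, and the contribution of a single jump of
size comparable to `S` bounds its transform below by a power of `S` on the ball of radius `√S`,
uniformly in the regularization. -/
lemma isMixtureSymbol_exp_neg_rpow (hα0 : 0 < α) (hα : α < 1) {κ : ℝ} (hκ : 0 < κ) :
    IsMixtureSymbol V (fun x => rexp (-(κ * x ^ α))) ∧
    ∃ c S₀ : ℝ, 0 < c ∧ 1 ≤ S₀ ∧ ∀ S, S₀ ≤ S → ∀ y : V, ‖y‖ ^ 2 ≤ S → ∀ s ∈ Ioc (0 : ℝ) 1,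
      c * S ^ (-((Module.finrank ℝ V : ℝ) / 2 + α))
        ≤ gaussTransform (fun x => rexp (-(κ * x ^ α))) s y := by
  have hI := stableIntegral_pos hα0 hα
  set b := κ / stableIntegral α with hb
  have hb0 : 0 < b := by positivity
  set w : ℝ → ℝ := fun r => b * r ^ (-1 - α) with hwdef
  have hw : Measurable w := by fun_prop
  have hw0 : ∀ r, 0 < r → 0 ≤ w r := fun r hr => by positivity
  have hwi0 : IntegrableOn (fun r => r * w r) (Ioc 0 1) := by
    refine IntegrableOn.congr_fun ((integrableOn_mul_rpow hα).const_mul b) (fun r _ => ?_)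
      measurableSet_Ioc
    simp only [hwdef]; ring
  have hwi1 : IntegrableOn w (Ioi 1) :=
    (integrableOn_Ioi_rpow_of_lt (by linarith : -1 - α < -1) zero_lt_one).const_mul b
  have hA1 : Ioi (1 : ℝ) ⊆ Ioi 0 := Ioi_subset_Ioi zero_le_one
  have hw1 : ∀ r ∈ Ioi (1 : ℝ), 0 ≤ w r := fun r hr => hw0 r (hA1 hr)
  set g : ℝ → ℝ := fun x => rexp (-levyExponent (Ioc 0 1) w x) with hgdef
  have hg : IsMixtureSymbol V g := isMixtureSymbol_exp_neg_levyExponent hw hw0 hwi0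
  set M := ∫ r in Ioi 1, w r with hM
  set m := laplaceOn (Ioi 1) w with hm
  have hsplit : ∀ x, 0 ≤ x → rexp (-(κ * x ^ α)) = rexp (-M) * (g x * rexp (m x)) := by
    intro x hx
    have h1 : levyExponent (Ioi 0) w x = κ * x ^ α := by
      have : levyExponent (Ioi 0) w x
          = b * levyExponent (Ioi 0) (fun r => r ^ (-1 - α)) x := by
        rw [levyExponent, levyExponent, ← integral_const_mul]
        congr 1; funext r; simp only [hwdef]; ring
      rw [this, levyExponent_rpow hα0 hx, hb]
      field_simp
    have h2 : levyExponent (Ioi 0) w x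
        = levyExponent (Ioc 0 1) w x + levyExponent (Ioi 1) w x := by
      have hi : IntegrableOn (fun r => (1 - rexp (-(x * r))) * w r) (Ioi 0) := by
        refine IntegrableOn.congr_fun ((integrableOn_levy_rpow hα0 hα hx).const_mul b)
          (fun r _ => ?_) measurableSet_Ioi
        simp only [hwdef]; ring
      rw [levyExponent, ← Ioc_union_Ioi_eq_Ioi (zero_le_one' ℝ),
        setIntegral_union (Ioc_disjoint_Ioi le_rfl) measurableSet_Ioi
          (hi.mono_set fun r hr => hr.1) (hi.mono_set hA1)]
      rfl
    rw [← h1, h2, levyExponent_eq measurableSet_Ioi hA1 hw hwi1 hx, hgdef]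
    simp only
    rw [← Real.exp_add, ← Real.exp_add]
    congr 1; ring
  have hfull : IsMixtureSymbol V fun x => rexp (-M) * (g x * rexp (m x)) :=
    (hg.mul_exp_laplaceOn measurableSet_Ioi hA1 hw hwi1 hw1).const_mul (Real.exp_nonneg _)
  have hT : ∀ s (y : V), gaussTransform (fun x => rexp (-(κ * x ^ α))) s y
      = gaussTransform (fun x => rexp (-M) * (g x * rexp (m x))) s y := fun s y => by
    simp only [gaussTransform]
    congr 1; funext ξ
    rw [hsplit _ (by positivity)]
  have hg1 : ∀ x, 0 ≤ x → |g x| ≤ 1 := fun x hx => by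
    rw [hgdef, Real.abs_exp, Real.exp_le_one_iff, neg_nonpos]
    exact levyExponent_nonneg measurableSet_Ioc (fun r hr => hr.1) (fun r hr => hw0 r hr.1) hx
  refine ⟨⟨by fun_prop, ⟨1, fun x hx => ?_⟩, fun s hs => ?_⟩, ?_⟩
  · rw [Real.abs_exp, Real.exp_le_one_iff, neg_nonpos]
    positivity
  · rw [show gaussTransform (V := V) (fun x => rexp (-(κ * x ^ α))) s = _ from funext (hT s)]
    exact hfull.mixture s hs
  · obtain ⟨S₀, hS₀, hlow⟩ := le_gaussTransform_of_one_sub_le (V := V) hg.measurable hg1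
      (C := ∫ r in Ioc 0 1, r * w r) (fun x hx => (one_sub_exp_neg_le _).trans
        (levyExponent_le measurableSet_Ioc (fun r hr => hr.1) hw (fun r hr => hw0 r hr.1)
          hwi0 hx))
    set p := (Module.finrank ℝ V : ℝ) / 2 with hp
    have hp0 : 0 ≤ p := by positivity
    refine ⟨rexp (-M) * (b * 2 ^ (-1 - α) * (rexp (-π ^ 2) / 2 * (π / 3) ^ p)), S₀,
      by positivity, hS₀, fun S hS y hy s hs => ?_⟩
    have hS1 : 1 ≤ S := hS₀.trans hS
    have hS0 : 0 < S := by linarith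
    -- Discard every term of the exponential series except the single-jump one.
    have hone : gaussTransform (fun x => g x * m x) s y
        ≤ gaussTransform (fun x => g x * rexp (m x)) s y := by
      have h1 := ((hg.mul_exp_laplaceOn_sub measurableSet_Ioi hA1 hw hwi1 hw1).mixture s
        hs.1).nonneg y
      have hga := hg.mul_exp_laplaceOn measurableSet_Ioi hA1 hw hwi1 hw1
      have hgb := hg.mul_laplaceOn measurableSet_Ioi hA1 hw hwi1 hw1
      obtain ⟨C1, hC1⟩ := hga.bounded
      obtain ⟨C2, hC2⟩ := hgb.bounded
      have ia := integrable_gaussTransform hga.measurable hC1 hs.1 y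
      have ib := integrable_gaussTransform hgb.measurable hC2 hs.1 y
      have : gaussTransform (fun x => g x * (rexp (m x) - m x)) s y
          = gaussTransform (fun x => g x * rexp (m x)) s y
            - gaussTransform (fun x => g x * m x) s y := by
        rw [gaussTransform, gaussTransform, gaussTransform, ← integral_sub ia ib]
        congr 1; funext ξ; ring
      rw [this] at h1
      linarith
    obtain ⟨hint, heq⟩ := gaussTransform_mul_laplaceOn hg.measurable hg1 measurableSet_Ioi hA1 hw
      hwi1 hs.1 y
    have hsub : Ioc S (2 * S) ⊆ Ioi 1 := fun r hr => lt_of_le_of_lt hS1 hr.1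
    have hjump : ∫ r in Ioc S (2 * S),
          b * (2 * S) ^ (-1 - α) * (rexp (-π ^ 2) / 2 * (π / (3 * S)) ^ p)
        ≤ gaussTransform (fun x => g x * m x) s y := by
      rw [heq]
      refine le_trans (setIntegral_mono_on (integrableOn_const (by simp)) (hint.mono_set hsub) measurableSet_Ioc
        fun r hr => ?_) (setIntegral_mono_set hint ?_ hsub.eventuallyLE)
      · have hr0 : 0 < r := hS0.trans hr.1
        have h3 : s + r ≤ 3 * S := by linarith [hs.2, hr.2]
        have hsr : S ≤ s + r := by linarith [hs.1, hr.1]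
        refine mul_le_mul ?_ (le_trans ?_ (hlow (s + r) (hS.trans hsr) y (hy.trans hsr)))
          (by positivity) (hw0 r hr0)
        · exact mul_le_mul_of_nonneg_left
            (Real.rpow_le_rpow_of_nonpos hr0 hr.2 (by linarith)) hb0.le
        · have : 0 < s + r := by linarith
          gcongr
      · filter_upwards [ae_restrict_mem measurableSet_Ioi] with r hr
        exact mul_nonneg (hw1 r hr)
          ((hg.mixture (s + r) (add_pos hs.1 (hA1 hr))).nonneg y)
    rw [setIntegral_const, smul_eq_mul] at hjump
    have hvol : volume.real (Ioc S (2 * S)) = S := by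
      rw [Real.volume_real_Ioc_of_le (by linarith)]; ring
    rw [hvol] at hjump
    have hTy : gaussTransform (fun x => rexp (-(κ * x ^ α))) s y
        = rexp (-M) * gaussTransform (fun x => g x * rexp (m x)) s y := by
      rw [hT, gaussTransform, gaussTransform, ← integral_const_mul]
      congr 1; funext ξ; ring
    rw [hTy, mul_assoc]
    refine mul_le_mul_of_nonneg_left (le_trans (le_of_eq ?_) (hjump.trans hone))
      (Real.exp_nonneg _)
    have e1 : (π / (3 * S)) ^ p = (π / 3) ^ p * S ^ (-p) := by
      rw [← div_div, Real.div_rpow (by positivity) hS0.le, Real.rpow_neg hS0.le, div_eq_mul_inv]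
    have e2 : S * S ^ (-1 - α) * S ^ (-p) = S ^ (-(p + α)) := by
      rw [← Real.rpow_one_add' hS0.le (by linarith), ← Real.rpow_add hS0]
      congr 1; ring
    rw [e1, Real.mul_rpow (by norm_num) hS0.le, ← e2]
    ring

end Stable

/-! ### The isotropic stable kernel -/

section Kernel

variable {V : Type*} [NormedAddCommGroup V] [InnerProductSpace ℝ V] [FiniteDimensional ℝ V]
  [MeasurableSpace V] [BorelSpace V]

/-- The inverse Fourier transform of `ξ ↦ exp (-κ ‖ξ‖ ^ β)`, written as a cosine integral. -/
noncomputable def stableKernel (κ β : ℝ) (y : V) : ℝ :=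
  ∫ ξ : V, Real.cos (2 * π * inner ℝ ξ y) * rexp (-(κ * ‖ξ‖ ^ β))

variable {κ β : ℝ}

lemma sq_rpow_half {r : ℝ} (hr : 0 ≤ r) : (r ^ 2) ^ (β / 2) = r ^ β := by
  rw [← Real.rpow_natCast, ← Real.rpow_mul hr]
  congr 1; push_cast; ring

lemma norm_cos_mul_exp_le (a b : ℝ) : ‖Real.cos a * rexp b‖ ≤ rexp b := by
  rw [norm_mul, Real.norm_eq_abs, Real.norm_eq_abs, Real.abs_exp]
  exact mul_le_of_le_one_left (Real.exp_nonneg _) (Real.abs_cos_le_one _)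

lemma continuous_stableKernel_integrand {V : Type*} [NormedAddCommGroup V]
    [InnerProductSpace ℝ V] (hβ : 0 < β) (y : V) :
    Continuous fun ξ : V => Real.cos (2 * π * inner ℝ ξ y) * rexp (-(κ * ‖ξ‖ ^ β)) := by
  have : Continuous fun ξ : V => ‖ξ‖ ^ β := continuous_norm.rpow_const fun _ => Or.inr hβ.le
  fun_prop

lemma stableKernel_neg (y : V) : stableKernel κ β (-y) = stableKernel κ β y := by
  simp [stableKernel]

section
variable [Nontrivial V]

lemma integrable_norm_pow_mul_exp_neg_rpow (hκ : 0 < κ) (hβ : 0 < β) (k : ℕ) :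
    Integrable fun ξ : V => ‖ξ‖ ^ k * rexp (-(κ * ‖ξ‖ ^ β)) := by
  refine (integrable_fun_norm_addHaar volume
    (f := fun r : ℝ => r ^ k * rexp (-(κ * r ^ β)))).2 ?_
  have := integrableOn_rpow_mul_exp_neg_mul_rpow (p := β) (b := κ)
    (s := ((Module.finrank ℝ V - 1 + k : ℕ) : ℝ))
    (lt_of_lt_of_le (by norm_num) (Nat.cast_nonneg _)) hβ hκ
  refine this.congr_fun (fun r _ => ?_) measurableSet_Ioi
  simp only [Real.rpow_natCast, pow_add, smul_eq_mul, neg_mul]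
  ring

lemma integrable_exp_neg_rpow (hκ : 0 < κ) (hβ : 0 < β) :
    Integrable fun ξ : V => rexp (-(κ * ‖ξ‖ ^ β)) := by
  simpa using integrable_norm_pow_mul_exp_neg_rpow (V := V) hκ hβ 0

lemma integrable_stableKernel (hκ : 0 < κ) (hβ : 0 < β) (y : V) :
    Integrable fun ξ : V => Real.cos (2 * π * inner ℝ ξ y) * rexp (-(κ * ‖ξ‖ ^ β)) :=
  (integrable_exp_neg_rpow hκ hβ).mono'
    (continuous_stableKernel_integrand hβ y).aestronglyMeasurable
    (Eventually.of_forall fun _ => norm_cos_mul_exp_le _ _)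

lemma continuous_stableKernel (hκ : 0 < κ) (hβ : 0 < β) :
    Continuous (stableKernel (V := V) κ β) :=
  continuous_of_dominated
    (fun y => (continuous_stableKernel_integrand hβ y).aestronglyMeasurable)
    (fun _ => Eventually.of_forall fun _ => norm_cos_mul_exp_le _ _)
    (integrable_exp_neg_rpow hκ hβ) (Eventually.of_forall fun _ => by fun_prop)

lemma tendsto_gaussTransform_stableKernel (hκ : 0 < κ) (hβ : 0 < β) (y : V) :
    Tendsto (fun s => gaussTransform (fun x => rexp (-(κ * x ^ (β / 2)))) s y) (𝓝[>] 0)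
      (𝓝 (stableKernel κ β y)) := by
  refine tendsto_integral_filter_of_dominated_convergence
    (fun ξ : V => rexp (-(κ * ‖ξ‖ ^ β))) ?_ ?_ (integrable_exp_neg_rpow hκ hβ)
    (Eventually.of_forall fun ξ => ?_)
  · filter_upwards [self_mem_nhdsWithin] with s hs
    refine (integrable_gaussTransform (g := fun x => rexp (-(κ * x ^ (β / 2))))
      (C := 1) (by fun_prop) (fun x hx => ?_) hs y).1
    rw [Real.abs_exp, Real.exp_le_one_iff, neg_nonpos]
    positivity
  · filter_upwards [self_mem_nhdsWithin] with s (hs : 0 < s)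
    refine Eventually.of_forall fun ξ => ?_
    rw [sq_rpow_half (norm_nonneg ξ), ← Real.exp_add]
    refine (norm_cos_mul_exp_le _ _).trans (Real.exp_le_exp.2 ?_)
    have : 0 ≤ s * ‖ξ‖ ^ 2 := by positivity
    linarith
  · have h : Tendsto (fun s : ℝ => rexp (-(s * ‖ξ‖ ^ 2))) (𝓝[>] 0) (𝓝 1) := by
      have : Continuous fun s : ℝ => rexp (-(s * ‖ξ‖ ^ 2)) := by fun_prop
      simpa using (this.tendsto 0).mono_left nhdsWithin_le_nhds
    simp only [sq_rpow_half (norm_nonneg ξ)]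
    simpa using (h.const_mul (rexp (-(κ * ‖ξ‖ ^ β)))).const_mul
      (Real.cos (2 * π * inner ℝ ξ y))

lemma isGaussianMixture_stableKernel (hκ : 0 < κ) (hβ : β ∈ Ioo (0 : ℝ) 2) :
    IsGaussianMixture (stableKernel (V := V) κ β) := by
  have h := (isMixtureSymbol_exp_neg_rpow (V := V) (half_pos hβ.1)
    (by linarith [hβ.2] : β / 2 < 1) hκ).1
  refine IsGaussianMixture.of_tendsto (l := 𝓝[>] (0 : ℝ)) ?_
    (tendsto_gaussTransform_stableKernel hκ hβ.1)
  filter_upwards [self_mem_nhdsWithin] with s hs using h.mixture s hs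

lemma le_stableKernel (hκ : 0 < κ) (hβ : β ∈ Ioo (0 : ℝ) 2) :
    ∃ c S₀ : ℝ, 0 < c ∧ 1 ≤ S₀ ∧ ∀ S, S₀ ≤ S → ∀ y : V, ‖y‖ ^ 2 ≤ S →
      c * S ^ (-((Module.finrank ℝ V : ℝ) / 2 + β / 2)) ≤ stableKernel κ β y := by
  obtain ⟨c, S₀, hc, hS₀, h⟩ := (isMixtureSymbol_exp_neg_rpow (V := V) (half_pos hβ.1)
    (by linarith [hβ.2] : β / 2 < 1) hκ).2
  refine ⟨c, S₀, hc, hS₀, fun S hS y hy =>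
    ge_of_tendsto (tendsto_gaussTransform_stableKernel hκ hβ.1 y) ?_⟩
  filter_upwards [Ioc_mem_nhdsGT one_pos] with s hs using h S hS y hy s hs

lemma stableKernel_pos (hκ : 0 < κ) (hβ : β ∈ Ioo (0 : ℝ) 2) (y : V) :
    0 < stableKernel κ β y := by
  obtain ⟨c, S₀, hc, hS₀, h⟩ := le_stableKernel (V := V) hκ hβ
  have hS : 0 < max S₀ (‖y‖ ^ 2) := lt_max_of_lt_left (by linarith)
  exact lt_of_lt_of_le (by positivity) (h _ (le_max_left _ _) y (le_max_right _ _))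

lemma stableKernel_lt_zero (hκ : 0 < κ) (hβ : 0 < β) {y : V} (hy : y ≠ 0) :
    stableKernel κ β y < stableKernel κ β (0 : V) := by
  rw [← sub_pos, stableKernel, stableKernel, ← integral_sub (integrable_stableKernel hκ hβ 0)
    (integrable_stableKernel hκ hβ y)]
  refine integral_pos_of_integrable_nonneg_nonzero
    ((continuous_stableKernel_integrand hβ 0).sub (continuous_stableKernel_integrand hβ y))
    ((integrable_stableKernel hκ hβ 0).sub (integrable_stableKernel hκ hβ y)) (fun ξ => ?_)
    (x := (1 / (2 * ‖y‖ ^ 2)) • y) ?_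
  · simp only [inner_zero_right, mul_zero, Real.cos_zero, Pi.zero_apply, ← sub_mul]
    exact mul_nonneg (sub_nonneg.2 (Real.cos_le_one _)) (Real.exp_nonneg _)
  · -- At this frequency the phase equals `π`.
    have hy' : ‖y‖ ≠ 0 := norm_ne_zero_iff.2 hy
    have : 2 * π * inner ℝ ((1 / (2 * ‖y‖ ^ 2)) • y) y = π := by
      rw [real_inner_smul_left, real_inner_self_eq_norm_sq]
      field_simp
    simp only [this, inner_zero_right, mul_zero, Real.cos_zero, Real.cos_pi, ← sub_mul]
    positivity

lemma stableKernel_le_zero (hκ : 0 < κ) (hβ : 0 < β) (y : V) :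
    stableKernel κ β y ≤ stableKernel κ β (0 : V) := by
  by_cases hy : y = 0
  · rw [hy]
  · exact (stableKernel_lt_zero hκ hβ hy).le

lemma abs_secondDiff_stableKernel_le (hκ : 0 < κ) (hβ : 0 < β) :
    ∃ C : ℝ, 0 ≤ C ∧ ∀ y σ : V,
      |stableKernel κ β (y + σ) + stableKernel κ β (y - σ) - 2 * stableKernel κ β y|
        ≤ C * ‖σ‖ ^ 2 := by
  have hI := integrable_norm_pow_mul_exp_neg_rpow (V := V) hκ hβ 2
  refine ⟨4 * π ^ 2 * ∫ ξ : V, ‖ξ‖ ^ 2 * rexp (-(κ * ‖ξ‖ ^ β)),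
    mul_nonneg (by positivity) (integral_nonneg fun _ => by positivity), fun y σ => ?_⟩
  have i := fun z : V => integrable_stableKernel hκ hβ z
  have e : stableKernel κ β (y + σ) + stableKernel κ β (y - σ) - 2 * stableKernel κ β y
      = ∫ ξ : V, -(2 * Real.cos (2 * π * inner ℝ ξ y)
          * (1 - Real.cos (2 * π * inner ℝ ξ σ)) * rexp (-(κ * ‖ξ‖ ^ β))) := by
    have h2 : Integrable fun ξ : V => Real.cos (2 * π * inner ℝ ξ (y + σ))
        * rexp (-(κ * ‖ξ‖ ^ β)) + Real.cos (2 * π * inner ℝ ξ (y - σ))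
        * rexp (-(κ * ‖ξ‖ ^ β)) := (i _).add (i _)
    rw [stableKernel, stableKernel, stableKernel, ← integral_const_mul,
      ← integral_add (i _) (i _), ← integral_sub h2 ((i _).const_mul 2)]
    congr 1; funext ξ
    rw [inner_add_right, inner_sub_right, mul_add, mul_sub, Real.cos_add, Real.cos_sub]
    ring
  rw [e, ← Real.norm_eq_abs, mul_right_comm, ← integral_const_mul]
  refine norm_integral_le_of_norm_le (hI.const_mul _)
    (Eventually.of_forall fun ξ => ?_)
  rw [norm_neg, norm_mul, norm_mul, norm_mul, Real.norm_eq_abs, Real.norm_eq_abs,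
    Real.norm_eq_abs, Real.norm_eq_abs, Real.abs_exp, abs_two,
    abs_of_nonneg (sub_nonneg.2 (Real.cos_le_one _))]
  have h1 : 1 - Real.cos (2 * π * inner ℝ ξ σ) ≤ (2 * π * (‖ξ‖ * ‖σ‖)) ^ 2 / 2 := by
    have hc := Real.one_sub_sq_div_two_le_cos (x := 2 * π * inner ℝ ξ σ)
    have hi : (2 * π * inner ℝ ξ σ) ^ 2 ≤ (2 * π * (‖ξ‖ * ‖σ‖)) ^ 2 := by
      rw [mul_pow (2 * π), mul_pow (2 * π)]
      gcongr (2 * π) ^ 2 * ?_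
      exact sq_le_sq' (by linarith [neg_le_of_abs_le (abs_real_inner_le_norm ξ σ)])
        (real_inner_le_norm ξ σ)
    linarith
  calc 2 * |Real.cos (2 * π * inner ℝ ξ y)| * (1 - Real.cos (2 * π * inner ℝ ξ σ))
        * rexp (-(κ * ‖ξ‖ ^ β))
      ≤ 2 * 1 * ((2 * π * (‖ξ‖ * ‖σ‖)) ^ 2 / 2) * rexp (-(κ * ‖ξ‖ ^ β)) := by
        gcongr
        · exact sub_nonneg.2 (Real.cos_le_one _)
        · exact Real.abs_cos_le_one _
    _ = _ := by ring

/-! ### The logarithm of the stable kernel -/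

/-- The second difference of `log` of the kernel is most negative at the origin. -/
lemma log_stableKernel_secondDiff_ge (hκ : 0 < κ) (hβ : β ∈ Ioo (0 : ℝ) 2) (y σ : V) :
    2 * log (stableKernel κ β σ) - 2 * log (stableKernel κ β (0 : V))
      ≤ log (stableKernel κ β (y + σ)) + log (stableKernel κ β (y - σ))
        - 2 * log (stableKernel κ β y) := by
  have hp := fun z : V => stableKernel_pos hκ hβ z
  have hn := fun z : V => (hp z).ne'
  have h := Real.log_le_log (by have := hp y; have := hp σ; positivity)
    ((isGaussianMixture_stableKernel hκ hβ).sq_mul_le hp y σ)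
  rw [Real.log_pow, Real.log_mul (hn _) (hn _), Real.log_mul (pow_ne_zero _ (hn _))
    (mul_ne_zero (hn _) (hn _)), Real.log_pow, Real.log_mul (hn _) (hn _)] at h
  push_cast at h
  linarith

/-- The logarithm of the kernel decays more slowly than any negative power. -/
lemma log_stableKernel_zero_sub_le (hκ : 0 < κ) (hβ : β ∈ Ioo (0 : ℝ) 2) {γ : ℝ} (hγ : 0 < γ) :
    ∃ D : ℝ, 0 ≤ D ∧ ∀ z : V,
      log (stableKernel κ β (0 : V)) - log (stableKernel κ β z) ≤ D * (1 + ‖z‖) ^ γ := by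
  obtain ⟨c, S₀, hc, hS₀, h⟩ := le_stableKernel (V := V) hκ hβ
  set N := (Module.finrank ℝ V : ℝ) / 2 + β / 2 with hN
  have hN0 : 0 ≤ N := by have := hβ.1; positivity
  set B := log (stableKernel κ β (0 : V)) - log c + N * log S₀ with hB
  refine ⟨|B| + 2 * N / γ, by positivity, fun z => ?_⟩
  have hz : 1 ≤ 1 + ‖z‖ := by linarith [norm_nonneg z]
  have hS1 : S₀ ≤ S₀ * (1 + ‖z‖) ^ 2 :=
    le_mul_of_one_le_right (by linarith) (one_le_pow₀ hz)
  have hS2 : ‖z‖ ^ 2 ≤ S₀ * (1 + ‖z‖) ^ 2 :=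
    (pow_le_pow_left₀ (norm_nonneg z) (by linarith) 2).trans
      (le_mul_of_one_le_left (by positivity) hS₀)
  have hS : 0 < S₀ * (1 + ‖z‖) ^ 2 := by linarith
  have hl := Real.log_le_log (by positivity) (h _ hS1 z hS2)
  rw [Real.log_mul hc.ne' (Real.rpow_pos_of_pos hS _).ne', Real.log_rpow hS,
    Real.log_mul (by linarith) (by positivity), Real.log_pow] at hl
  have hlog := Real.log_le_rpow_div (by linarith : 0 ≤ 1 + ‖z‖) hγ
  have h1 : 1 ≤ (1 + ‖z‖) ^ γ := Real.one_le_rpow hz hγ.le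
  have h2 := mul_le_mul_of_nonneg_left hlog (by positivity : 0 ≤ 2 * N)
  have h3 : B ≤ |B| * (1 + ‖z‖) ^ γ :=
    (le_abs_self B).trans (le_mul_of_one_le_right (abs_nonneg B) h1)
  push_cast at hl
  calc _ ≤ B + 2 * N * log (1 + ‖z‖) := by rw [hB]; linarith
    _ ≤ |B| * (1 + ‖z‖) ^ γ + 2 * N * ((1 + ‖z‖) ^ γ / γ) := add_le_add h3 h2
    _ = _ := by ring

lemma min_sq_rpow_of_le_one {r γ : ℝ} (hr : 0 ≤ r) (hr1 : r ≤ 1) (hγ : 0 < γ) (hγ2 : γ ≤ 2) :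
    min (r ^ 2) (r ^ γ) = r ^ 2 := by
  refine min_eq_left ?_
  rw [← Real.rpow_natCast]
  exact Real.rpow_le_rpow_of_exponent_ge' hr hr1 hγ.le (by exact_mod_cast hγ2)

lemma min_sq_rpow_of_one_le {r γ : ℝ} (hr1 : 1 ≤ r) (hγ2 : γ ≤ 2) :
    min (r ^ 2) (r ^ γ) = r ^ γ := by
  refine min_eq_right ?_
  rw [← Real.rpow_natCast]
  exact Real.rpow_le_rpow_of_exponent_le hr1 (by exact_mod_cast hγ2)

lemma log_stableKernel_zero_sub_le_min (hκ : 0 < κ) (hβ : β ∈ Ioo (0 : ℝ) 2) {γ : ℝ}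
    (hγ : 0 < γ) (hγ2 : γ ≤ 2) :
    ∃ D : ℝ, 0 ≤ D ∧ ∀ z : V, log (stableKernel κ β (0 : V)) - log (stableKernel κ β z)
      ≤ D * min (‖z‖ ^ 2) (‖z‖ ^ γ) := by
  obtain ⟨D, hD, h⟩ := log_stableKernel_zero_sub_le (V := V) hκ hβ hγ
  obtain ⟨C, hC, hC2⟩ := abs_secondDiff_stableKernel_le (V := V) hκ hβ.1
  obtain ⟨c, S₀, hc, hS₀, hlow⟩ := le_stableKernel (V := V) hκ hβ
  set c' := c * S₀ ^ (-((Module.finrank ℝ V : ℝ) / 2 + β / 2)) with hc'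
  have hc'0 : 0 < c' := by positivity
  refine ⟨C / c' + D * 2 ^ γ, by positivity, fun z => ?_⟩
  rcases le_total ‖z‖ 1 with hz | hz
  · rw [min_sq_rpow_of_le_one (norm_nonneg z) hz hγ hγ2]
    have hK : c' ≤ stableKernel κ β z :=
      hlow S₀ le_rfl z ((pow_le_one₀ (norm_nonneg z) hz).trans hS₀)
    have hKz := stableKernel_pos hκ hβ z
    have hK0 := stableKernel_pos hκ hβ (0 : V)
    have h2 := (abs_le.1 (hC2 0 z)).1
    rw [zero_add, zero_sub, stableKernel_neg] at h2
    calc _ = log (stableKernel κ β (0 : V) / stableKernel κ β z) :=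
          (Real.log_div hK0.ne' hKz.ne').symm
      _ ≤ stableKernel κ β (0 : V) / stableKernel κ β z - 1 :=
          Real.log_le_sub_one_of_pos (by positivity)
      _ = (stableKernel κ β (0 : V) - stableKernel κ β z) / stableKernel κ β z := by
          field_simp
      _ ≤ C * ‖z‖ ^ 2 / c' := by
          gcongr
          nlinarith [mul_nonneg hC (sq_nonneg ‖z‖)]
      _ = C / c' * ‖z‖ ^ 2 := by ring
      _ ≤ _ := by
          gcongr
          exact le_add_of_nonneg_right (by positivity)
  · rw [min_sq_rpow_of_one_le hz hγ2]
    calc _ ≤ D * (1 + ‖z‖) ^ γ := h z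
      _ ≤ D * (2 * ‖z‖) ^ γ := by gcongr; linarith
      _ = D * 2 ^ γ * ‖z‖ ^ γ := by
          rw [Real.mul_rpow (by norm_num) (norm_nonneg z), mul_assoc]
      _ ≤ _ := by
          gcongr
          exact le_add_of_nonneg_left (by positivity)

/-- The lower bound comes from the origin, where the second difference is most negative; the
upper bound from concavity of `log` and from the maximum of the kernel at the origin. -/
lemma abs_secondDiff_log_stableKernel_le (hκ : 0 < κ) (hβ : β ∈ Ioo (0 : ℝ) 2) {γ : ℝ}
    (hγ : 0 < γ) (hγ2 : γ ≤ 2) (y : V) :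
    ∃ D : ℝ, ∀ σ : V, |log (stableKernel κ β (y + σ)) + log (stableKernel κ β (y - σ))
        - 2 * log (stableKernel κ β y)| ≤ D * min (‖σ‖ ^ 2) (‖σ‖ ^ γ) := by
  obtain ⟨D, hD, h⟩ := log_stableKernel_zero_sub_le_min (V := V) hκ hβ hγ hγ2
  obtain ⟨C, hC, hC2⟩ := abs_secondDiff_stableKernel_le (V := V) hκ hβ.1
  have hp := fun z : V => stableKernel_pos hκ hβ z
  have hlog : ∀ z : V, log (stableKernel κ β z) ≤ log (stableKernel κ β (0 : V)) := fun z =>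
    Real.log_le_log (hp z) (stableKernel_le_zero hκ hβ.1 z)
  set B := 2 * (log (stableKernel κ β (0 : V)) - log (stableKernel κ β y)) with hB
  have hB0 : 0 ≤ B := by linarith [hlog y]
  have hCy : 0 ≤ C / stableKernel κ β y := div_nonneg hC (hp y).le
  refine ⟨2 * D + (C / stableKernel κ β y + B), fun σ => ?_⟩
  have hmin : 0 ≤ min (‖σ‖ ^ 2) (‖σ‖ ^ γ) := by positivity
  rw [abs_le, add_mul]
  constructor
  · have h1 := log_stableKernel_secondDiff_ge hκ hβ y σ
    have h2 := mul_nonneg (add_nonneg hCy hB0) hmin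
    linarith [h σ]
  · have hDm := mul_nonneg hD hmin
    have hBm := mul_nonneg hB0 hmin
    have hCm := mul_nonneg hCy hmin
    rcases le_total ‖σ‖ 1 with hσ | hσ
    · have h2 := (abs_le.1 (hC2 y σ)).2
      have hy := (hp y).ne'
      have hlogle : ∀ z : V, log (stableKernel κ β z) - log (stableKernel κ β y)
          ≤ stableKernel κ β z / stableKernel κ β y - 1 := fun z => by
        rw [← Real.log_div (hp z).ne' hy]
        exact Real.log_le_sub_one_of_pos (div_pos (hp z) (hp y))
      have h3 : stableKernel κ β (y + σ) / stableKernel κ β y - 1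
          + (stableKernel κ β (y - σ) / stableKernel κ β y - 1)
          ≤ C / stableKernel κ β y * ‖σ‖ ^ 2 := by
        have := div_le_div_of_nonneg_right h2 (hp y).le
        calc _ = (stableKernel κ β (y + σ) + stableKernel κ β (y - σ)
                - 2 * stableKernel κ β y) / stableKernel κ β y := by field_simp; ring
          _ ≤ _ := this
          _ = _ := by ring
      rw [← min_sq_rpow_of_le_one (norm_nonneg σ) hσ hγ hγ2] at h3
      linarith [hlogle (y + σ), hlogle (y - σ)]
    · have h1 : 1 ≤ min (‖σ‖ ^ 2) (‖σ‖ ^ γ) :=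
        le_min (one_le_pow₀ hσ) (Real.one_le_rpow hσ hγ.le)
      have := le_mul_of_one_le_right hB0 h1
      linarith [hlog (y + σ), hlog (y - σ)]

lemma abs_log_stableKernel_sub_le (hκ : 0 < κ) (hβ : β ∈ Ioo (0 : ℝ) 2) {γ : ℝ} (hγ : 0 < γ)
    (y : V) {ε : ℝ} (hε : 0 < ε) :
    ∃ D : ℝ, ∀ h : V, ε ≤ ‖h‖ →
      |log (stableKernel κ β (y + h)) - log (stableKernel κ β y)| ≤ D * ‖h‖ ^ γ := by
  obtain ⟨D, hD, hlow⟩ := log_stableKernel_zero_sub_le (V := V) hκ hβ hγ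
  have hlog : ∀ z : V, log (stableKernel κ β z) ≤ log (stableKernel κ β (0 : V)) := fun z =>
    Real.log_le_log (stableKernel_pos hκ hβ z) (stableKernel_le_zero hκ hβ.1 z)
  refine ⟨D * ((1 + ‖y‖) / ε + 1) ^ γ, fun h hh => ?_⟩
  have hmul : 1 + ‖y‖ + ‖h‖ ≤ ((1 + ‖y‖) / ε + 1) * ‖h‖ := by
    have : 1 + ‖y‖ ≤ (1 + ‖y‖) / ε * ‖h‖ := by
      rw [div_mul_eq_mul_div, le_div_iff₀ hε]
      gcongr
    linarith
  have hany : ∀ z : V, ‖z‖ ≤ ‖y‖ + ‖h‖ →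
      log (stableKernel κ β (0 : V)) - log (stableKernel κ β z)
        ≤ D * ((1 + ‖y‖) / ε + 1) ^ γ * ‖h‖ ^ γ := fun z hz => by
    rw [mul_assoc, ← Real.mul_rpow (by positivity) (norm_nonneg h)]
    refine (hlow z).trans ?_
    gcongr
    linarith
  rw [abs_le]
  constructor
  · linarith [hany (y + h) (norm_add_le y h), hlog y]
  · linarith [hany y (by linarith [norm_nonneg h]), hlog (y + h)]

end

/-- Self-similarity of the kernel. -/
lemma stableKernel_scaling (hβ : 0 < β) {t : ℝ} (ht : 0 < t) (y : V) :
    stableKernel (t * κ) β y = (t ^ (-β⁻¹)) ^ Module.finrank ℝ V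
      * stableKernel κ β (t ^ (-β⁻¹) • y) := by
  set R := t ^ (-β⁻¹) with hR
  have hR0 : 0 < R := by positivity
  have hRβ : t * R ^ β = 1 := by
    rw [hR, ← Real.rpow_mul ht.le, neg_mul, inv_mul_cancel₀ hβ.ne', Real.rpow_neg_one,
      mul_inv_cancel₀ ht.ne']
  have h := Measure.integral_comp_smul (volume : Measure V)
    (fun ξ : V => Real.cos (2 * π * inner ℝ ξ y) * rexp (-(t * κ * ‖ξ‖ ^ β))) R
  have e : ∀ ξ : V, Real.cos (2 * π * inner ℝ (R • ξ) y) * rexp (-(t * κ * ‖R • ξ‖ ^ β))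
      = Real.cos (2 * π * inner ℝ ξ (R • y)) * rexp (-(κ * ‖ξ‖ ^ β)) := fun ξ => by
    rw [real_inner_smul_left, real_inner_smul_right, norm_smul, Real.norm_eq_abs,
      abs_of_pos hR0, Real.mul_rpow hR0.le (norm_nonneg ξ)]
    congr 3
    linear_combination κ * ‖ξ‖ ^ β * hRβ
  simp only [e] at h
  rw [stableKernel, stableKernel, h, abs_of_pos (by positivity), smul_eq_mul,
    mul_inv_cancel_left₀ (by positivity)]

end Kernel

/-! ### The fractional Laplacian -/

section FractionalLaplacian

variable {d : ℕ} {β : ℝ}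

lemma nontrivial_euclideanSpace (hd : 1 ≤ d) : Nontrivial (EuclideanSpace ℝ (Fin d)) :=
  Module.nontrivial_of_finrank_pos (R := ℝ) (by rw [finrank_euclideanSpace_fin]; omega)

lemma fracConst_pos (hβ : β ∈ Ioo (0 : ℝ) 2) : 0 < fracConst β d := by
  have h1 : 0 < Real.Gamma (((d : ℝ) + β) / 2) :=
    Real.Gamma_pos_of_pos (by have := hβ.1; positivity)
  have h2 : Real.Gamma (-(β / 2)) ≠ 0 := by
    refine Real.Gamma_ne_zero fun m hm => ?_
    have h : β = 2 * m := by linarith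
    have hm0 : (0 : ℝ) < m := by linarith [hβ.1]
    have hm1 : (m : ℝ) < 1 := by linarith [hβ.2]
    have : 0 < m := by exact_mod_cast hm0
    have : m < 1 := by exact_mod_cast hm1
    omega
  unfold fracConst
  positivity

/-- Near the origin the second order vanishing compensates the singularity of the kernel
`‖h‖ ^ (-d-β)`; at infinity it absorbs any growth of order less than `β`. -/
lemma integrable_min_div_norm_rpow (hd : 1 ≤ d) (hβ : β ∈ Ioo (0 : ℝ) 2) :
    Integrable fun h : EuclideanSpace ℝ (Fin d) =>
      min (‖h‖ ^ 2) (‖h‖ ^ (β / 2)) / ‖h‖ ^ ((d : ℝ) + β) := by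
  have := nontrivial_euclideanSpace hd
  refine (integrable_fun_norm_addHaar volume
    (f := fun r : ℝ => min (r ^ 2) (r ^ (β / 2)) / r ^ ((d : ℝ) + β))).2 ?_
  rw [finrank_euclideanSpace_fin]
  obtain ⟨hβ0, hβ2⟩ := hβ
  have hpow : ∀ r : ℝ, 0 < r → ∀ a : ℝ,
      r ^ (d - 1) • (r ^ a / r ^ ((d : ℝ) + β)) = r ^ (a - 1 - β) := fun r hr a => by
    rw [smul_eq_mul, ← Real.rpow_natCast, Nat.cast_sub hd, ← Real.rpow_sub hr,
      ← Real.rpow_add hr]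
    congr 1; push_cast; ring
  rw [← Ioc_union_Ioi_eq_Ioi (zero_le_one' ℝ)]
  refine IntegrableOn.union ?_ ?_
  · have h := (intervalIntegral.integrableOn_Ioo_rpow_iff (s := 2 - 1 - β) zero_lt_one).2
      (by linarith)
    rw [← integrableOn_Ioc_iff_integrableOn_Ioo] at h
    refine h.congr_fun (fun r hr => ?_) measurableSet_Ioc
    simp only [min_sq_rpow_of_le_one hr.1.le hr.2 (half_pos hβ0) (by linarith : β / 2 ≤ 2)]
    rw [← hpow r hr.1 2]
    norm_cast
  · refine (integrableOn_Ioi_rpow_of_lt (by linarith : β / 2 - 1 - β < -1)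
      zero_lt_one).congr_fun (fun r hr => ?_) measurableSet_Ioi
    simp only [min_sq_rpow_of_one_le (le_of_lt hr) (by linarith : β / 2 ≤ 2)]
    rw [hpow r (zero_lt_one.trans hr)]

/-- Symmetrizing the truncated integrals turns them into truncated integrals of second
differences, which converge to the full integral. -/
lemma hasFracLaplacianPV_of_integrable {f : EuclideanSpace ℝ (Fin d) → ℝ}
    {x : EuclideanSpace ℝ (Fin d)} (hd : 1 ≤ d)
    (hf : Integrable (secondDiffQuot β f x))
    (htr : ∀ ε : ℝ, 0 < ε →
      IntegrableOn (fun h => (f (x + h) - f x) / ‖h‖ ^ ((d : ℝ) + β)) (Metric.ball 0 ε)ᶜ) :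
    HasFracLaplacianPV β f x (fracLaplacian β f x) := by
  have := nontrivial_euclideanSpace hd
  set q : EuclideanSpace ℝ (Fin d) → ℝ :=
    fun h => (f (x + h) - f x) / ‖h‖ ^ ((d : ℝ) + β) with hq
  have hind : ∀ (ε : ℝ) (h : EuclideanSpace ℝ (Fin d)),
      (Metric.ball x ε)ᶜ.indicator (fun y => (f y - f x) / ‖x - y‖ ^ ((d : ℝ) + β)) (x + h)
        = (Metric.ball 0 ε)ᶜ.indicator q h := fun ε h => by
    simp [indicator, hq, Metric.mem_ball, dist_eq_norm]
  have hneg : ∀ (ε : ℝ) (h : EuclideanSpace ℝ (Fin d)),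
      (Metric.ball 0 ε)ᶜ.indicator (secondDiffQuot β f x) h
        = (Metric.ball 0 ε)ᶜ.indicator q h + (Metric.ball 0 ε)ᶜ.indicator q (-h) :=
    fun ε h => by
      by_cases hh : ‖h‖ < ε
      · simp [indicator, Metric.mem_ball, dist_eq_norm, hh]
      · simp only [indicator, hq, Metric.mem_ball, dist_eq_norm, hh, mem_compl_iff, sub_zero,
          norm_neg, not_false_eq_true, if_true, secondDiffQuot]
        rw [← sub_eq_add_neg]; ring
  have hmeas : ∀ (z : EuclideanSpace ℝ (Fin d)) ε, MeasurableSet (Metric.ball z ε)ᶜ :=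
    fun z ε => measurableSet_ball.compl
  have hqi : ∀ ε, 0 < ε → Integrable ((Metric.ball 0 ε)ᶜ.indicator q) := fun ε hε =>
    (integrable_indicator_iff (hmeas 0 ε)).2 (htr ε hε)
  have hhalf : ∀ ε, 0 < ε →
      ∫ y in (Metric.ball x ε)ᶜ, (f y - f x) / ‖x - y‖ ^ ((d : ℝ) + β)
        = 1 / 2 * ∫ h, (Metric.ball 0 ε)ᶜ.indicator (secondDiffQuot β f x) h := fun ε hε => by
    rw [← integral_indicator (hmeas x ε), ← integral_add_left_eq_self _ x]
    simp only [hind, hneg]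
    rw [integral_add (hqi ε hε) (hqi ε hε).comp_neg, integral_neg_eq_self]
    ring
  refine ⟨fun ε hε => ?_, ?_⟩
  · rw [← integrable_indicator_iff (hmeas x ε)]
    have := (hqi ε hε).comp_sub_right x
    refine this.congr (Eventually.of_forall fun y => ?_)
    simp only
    rw [← hind]; simp
  · have hlim : Tendsto (fun ε : ℝ => ∫ h,
        (Metric.ball 0 ε)ᶜ.indicator (secondDiffQuot β f x) h) (𝓝[>] 0)
        (𝓝 (∫ h, secondDiffQuot β f x h)) := by
      refine tendsto_integral_filter_of_dominated_convergence _
        (Eventually.of_forall fun ε => hf.1.indicator (hmeas 0 ε))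
        (Eventually.of_forall fun ε => Eventually.of_forall fun h =>
          norm_indicator_le_norm_self _ _) hf.norm ?_
      filter_upwards [compl_mem_ae_iff.2 (measure_singleton (0 : EuclideanSpace ℝ (Fin d)))]
        with h hh
      refine tendsto_const_nhds.congr' ?_
      have hpos : 0 < ‖h‖ := norm_pos_iff.2 hh
      filter_upwards [Ioo_mem_nhdsGT hpos] with ε hε
      rw [indicator_of_mem]
      simpa [Metric.mem_ball, dist_eq_norm] using hε.2.le
    have h2 := (hlim.const_mul (1 / 2)).const_mul (fracConst β d)
    have h3 := h2.neg
    have e : -(fracConst β d * (1 / 2 * ∫ h, secondDiffQuot β f x h))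
        = fracLaplacian β f x := by rw [fracLaplacian]; ring
    rw [e] at h3
    refine h3.congr' ?_
    filter_upwards [self_mem_nhdsWithin] with ε hε
    rw [hhalf ε hε]

lemma fracLaplacian_comp_smul_add_const {f : EuclideanSpace ℝ (Fin d) → ℝ} {R : ℝ} (hR : 0 < R)
    (a : ℝ) (x : EuclideanSpace ℝ (Fin d)) :
    fracLaplacian β (fun z => a + f (R • z)) x = R ^ β * fracLaplacian β f (R • x) := by
  have e : ∀ h, secondDiffQuot β (fun z => a + f (R • z)) x h
      = R ^ ((d : ℝ) + β) * secondDiffQuot β f (R • x) (R • h) := fun h => by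
    simp only [secondDiffQuot, smul_add, smul_sub, norm_smul, Real.norm_eq_abs, abs_of_pos hR]
    rw [Real.mul_rpow hR.le (norm_nonneg h)]
    have : R ^ ((d : ℝ) + β) ≠ 0 := by positivity
    rw [mul_div_assoc', mul_div_mul_left _ _ this]
    congr 1; ring
  have hs := Measure.integral_comp_smul
    (volume : Measure (EuclideanSpace ℝ (Fin d))) (secondDiffQuot β f (R • x)) R
  rw [finrank_euclideanSpace_fin, abs_of_pos (by positivity), smul_eq_mul] at hs
  rw [fracLaplacian, fracLaplacian]
  simp only [e]
  rw [integral_const_mul, hs, Real.rpow_add hR, Real.rpow_natCast]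
  field_simp

/-! ### The fractional heat kernel -/

lemma fracHeatKernel_eq_stableKernel (hd : 1 ≤ d) (hβ : 0 < β) {t : ℝ} (ht : 0 < t)
    (x : EuclideanSpace ℝ (Fin d)) :
    fracHeatKernel β t x = stableKernel (t * (2 * π) ^ β) β x := by
  have := nontrivial_euclideanSpace hd
  have hκ : 0 < t * (2 * π) ^ β := by positivity
  have e0 : ∀ ξ : EuclideanSpace ℝ (Fin d),
      t * (2 * π * ‖ξ‖) ^ β = t * (2 * π) ^ β * ‖ξ‖ ^ β := fun ξ => by
    rw [Real.mul_rpow (by positivity) (norm_nonneg ξ), mul_assoc]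
  have hcont : Continuous fun ξ : EuclideanSpace ℝ (Fin d) => ‖ξ‖ ^ β :=
    continuous_norm.rpow_const fun _ => Or.inr hβ.le
  have hint : Integrable fun ξ : EuclideanSpace ℝ (Fin d) =>
      Complex.exp (((2 * π * inner ℝ ξ x : ℝ) : ℂ) * Complex.I)
        • ((rexp (-(t * (2 * π) ^ β * ‖ξ‖ ^ β)) : ℝ) : ℂ) := by
    refine (integrable_exp_neg_rpow (V := EuclideanSpace ℝ (Fin d)) hκ hβ).mono'
      (Continuous.aestronglyMeasurable (by fun_prop)) (Eventually.of_forall fun ξ => ?_)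
    rw [norm_smul, Complex.norm_exp_ofReal_mul_I, one_mul, Complex.norm_real,
      Real.norm_eq_abs, Real.abs_exp]
  rw [fracHeatKernel, Real.fourierInv_eq', stableKernel]
  simp only [e0]
  rw [← RCLike.re_eq_complex_re, ← integral_re hint]
  congr 1; funext ξ
  rw [RCLike.re_eq_complex_re, smul_eq_mul, Complex.re_mul_ofReal, Complex.exp_ofReal_mul_I_re]

lemma integrable_secondDiffQuot_log (hd : 1 ≤ d) (hβ : β ∈ Ioo (0 : ℝ) 2) {κ : ℝ} (hκ : 0 < κ)
    (x : EuclideanSpace ℝ (Fin d)) :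
    Integrable (secondDiffQuot β (fun z => log (stableKernel κ β z)) x) := by
  have := nontrivial_euclideanSpace hd
  obtain ⟨D, hD⟩ := abs_secondDiff_log_stableKernel_le hκ hβ (half_pos hβ.1)
    (by linarith [hβ.2] : β / 2 ≤ 2) x
  have hc : Continuous fun z : EuclideanSpace ℝ (Fin d) => log (stableKernel κ β z) :=
    (continuous_stableKernel hκ hβ.1).log fun z => (stableKernel_pos hκ hβ z).ne'
  refine ((integrable_min_div_norm_rpow hd hβ).const_mul D).mono' ?_
    (Eventually.of_forall fun h => ?_)
  · have h1 : Continuous fun h : EuclideanSpace ℝ (Fin d) => log (stableKernel κ β (x + h))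
        + log (stableKernel κ β (x - h)) - 2 * log (stableKernel κ β x) :=
      ((hc.comp (by fun_prop : Continuous fun h => x + h)).add
        (hc.comp (by fun_prop : Continuous fun h => x - h))).sub continuous_const
    have h2 : Measurable fun h : EuclideanSpace ℝ (Fin d) => ‖h‖ ^ ((d : ℝ) + β) := by fun_prop
    exact (h1.measurable.div h2).aestronglyMeasurable
  · rw [secondDiffQuot, norm_div, Real.norm_eq_abs, Real.norm_eq_abs,
      abs_of_nonneg (by positivity : 0 ≤ ‖h‖ ^ ((d : ℝ) + β)), mul_div_assoc']
    exact div_le_div_of_nonneg_right (hD h) (by positivity)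

lemma integrableOn_log_sub_div (hd : 1 ≤ d) (hβ : β ∈ Ioo (0 : ℝ) 2) {κ : ℝ} (hκ : 0 < κ)
    (x : EuclideanSpace ℝ (Fin d)) {ε : ℝ} (hε : 0 < ε) :
    IntegrableOn (fun h => (log (stableKernel κ β (x + h)) - log (stableKernel κ β x))
      / ‖h‖ ^ ((d : ℝ) + β)) (Metric.ball 0 ε)ᶜ := by
  have := nontrivial_euclideanSpace hd
  have hγ : 0 < β / 2 := half_pos hβ.1
  have hγ2 : β / 2 ≤ 2 := by linarith [hβ.2]
  obtain ⟨D, hD⟩ := abs_log_stableKernel_sub_le hκ hβ hγ x hε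
  have hc : Continuous fun z : EuclideanSpace ℝ (Fin d) => log (stableKernel κ β z) :=
    (continuous_stableKernel hκ hβ.1).log fun z => (stableKernel_pos hκ hβ z).ne'
  -- Off the ball of radius `ε`, the power `‖h‖ ^ (β / 2)` is controlled by the minimum.
  have hpow : ∀ h : EuclideanSpace ℝ (Fin d), ε ≤ ‖h‖ →
      ‖h‖ ^ (β / 2) ≤ (1 + 1 / ε ^ 2) * min (‖h‖ ^ 2) (‖h‖ ^ (β / 2)) := fun h hh => by
    rcases le_total ‖h‖ 1 with h1 | h1
    · rw [min_sq_rpow_of_le_one (norm_nonneg h) h1 hγ hγ2]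
      have e1 : ‖h‖ ^ (β / 2) ≤ 1 := Real.rpow_le_one (norm_nonneg h) h1 hγ.le
      have e2 : 1 ≤ 1 / ε ^ 2 * ‖h‖ ^ 2 := by
        rw [one_div_mul_eq_div, le_div_iff₀ (by positivity), one_mul]
        gcongr
      nlinarith [sq_nonneg ‖h‖]
    · rw [min_sq_rpow_of_one_le h1 hγ2]
      exact le_mul_of_one_le_left (by positivity)
        (le_add_of_nonneg_right (by positivity))
  refine (((integrable_min_div_norm_rpow hd hβ).const_mul
    (|D| * (1 + 1 / ε ^ 2))).integrableOn).mono' ?_ ?_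
  · have h1 : Continuous fun h : EuclideanSpace ℝ (Fin d) =>
        log (stableKernel κ β (x + h)) - log (stableKernel κ β x) :=
      (hc.comp (by fun_prop : Continuous fun h => x + h)).sub continuous_const
    have h2 : Measurable fun h : EuclideanSpace ℝ (Fin d) => ‖h‖ ^ ((d : ℝ) + β) := by fun_prop
    exact (h1.measurable.div h2).aestronglyMeasurable
  · filter_upwards [ae_restrict_mem measurableSet_ball.compl] with h hh
    have hh' : ε ≤ ‖h‖ := by simpa [Metric.mem_ball, dist_eq_norm] using hh
    rw [norm_div, Real.norm_eq_abs, Real.norm_eq_abs,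
      abs_of_nonneg (by positivity : 0 ≤ ‖h‖ ^ ((d : ℝ) + β)), mul_div_assoc']
    refine div_le_div_of_nonneg_right ?_ (by positivity)
    calc _ ≤ D * ‖h‖ ^ (β / 2) := hD h hh'
      _ ≤ |D| * ‖h‖ ^ (β / 2) := by gcongr; exact le_abs_self D
      _ ≤ |D| * ((1 + 1 / ε ^ 2) * min (‖h‖ ^ 2) (‖h‖ ^ (β / 2))) := by
          gcongr; exact hpow h hh'
      _ = _ := by ring

/-! ### The Li-Yau constant -/

lemma fracProfile_eq_stableKernel (hd : 1 ≤ d) (hβ : 0 < β) (y : EuclideanSpace ℝ (Fin d)) :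
    fracProfile β y = stableKernel ((2 * π) ^ β) β y := by
  rw [fracProfile, fracHeatKernel_eq_stableKernel hd hβ one_pos, one_mul]

lemma liYauIntegrand_eq (hd : 1 ≤ d) (hβ : β ∈ Ioo (0 : ℝ) 2)
    (y : EuclideanSpace ℝ (Fin d)) :
    liYauIntegrand β y
      = fun σ => -secondDiffQuot β (fun z => log (stableKernel ((2 * π) ^ β) β z)) y σ := by
  have := nontrivial_euclideanSpace hd
  funext σ
  have hp := fun z : EuclideanSpace ℝ (Fin d) =>
    (stableKernel_pos (κ := (2 * π) ^ β) (by positivity) hβ z).ne'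
  simp only [liYauIntegrand, secondDiffQuot, fracProfile_eq_stableKernel hd hβ.1]
  rw [Real.log_div (pow_ne_zero _ (hp _)) (mul_ne_zero (hp _) (hp _)), Real.log_pow,
    Real.log_mul (hp _) (hp _), ← neg_div]
  congr 1; push_cast; ring

lemma integrable_liYauIntegrand (hd : 1 ≤ d) (hβ : β ∈ Ioo (0 : ℝ) 2)
    (y : EuclideanSpace ℝ (Fin d)) : Integrable (liYauIntegrand β y) := by
  rw [liYauIntegrand_eq hd hβ]
  exact (integrable_secondDiffQuot_log hd hβ (by positivity) y).neg

/-- The supremum defining the Li-Yau constant is attained at the origin. -/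
lemma integral_liYauIntegrand_le (hd : 1 ≤ d) (hβ : β ∈ Ioo (0 : ℝ) 2)
    (y : EuclideanSpace ℝ (Fin d)) :
    ∫ σ, liYauIntegrand β y σ ≤ ∫ σ : EuclideanSpace ℝ (Fin d), liYauIntegrand β 0 σ := by
  have := nontrivial_euclideanSpace hd
  refine integral_mono (integrable_liYauIntegrand hd hβ y) (integrable_liYauIntegrand hd hβ 0)
    fun σ => ?_
  simp only [liYauIntegrand_eq hd hβ, secondDiffQuot]
  rw [← neg_div, ← neg_div, zero_add, zero_sub, stableKernel_neg]
  refine div_le_div_of_nonneg_right ?_ (by positivity)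
  linarith [log_stableKernel_secondDiff_ge (κ := (2 * π) ^ β) (by positivity) hβ y σ]

lemma bddAbove_range_integral_liYauIntegrand (hd : 1 ≤ d) (hβ : β ∈ Ioo (0 : ℝ) 2) :
    BddAbove (range fun y : EuclideanSpace ℝ (Fin d) => ∫ σ, liYauIntegrand β y σ) :=
  ⟨_, by rintro _ ⟨y, rfl⟩; exact integral_liYauIntegrand_le hd hβ y⟩

lemma liYauConst_pos (hd : 1 ≤ d) (hβ : β ∈ Ioo (0 : ℝ) 2) : 0 < liYauConst β d := by
  have := nontrivial_euclideanSpace hd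
  have hκ : 0 < (2 * π) ^ β := by positivity
  have hpos : ∀ σ : EuclideanSpace ℝ (Fin d), σ ≠ 0 → 0 < liYauIntegrand β 0 σ := fun σ hσ => by
    have hlt := Real.log_lt_log (stableKernel_pos hκ hβ σ) (stableKernel_lt_zero hκ hβ.1 hσ)
    have hn : 0 < ‖σ‖ := norm_pos_iff.2 hσ
    simp only [liYauIntegrand_eq hd hβ, secondDiffQuot]
    rw [← neg_div, zero_add, zero_sub, stableKernel_neg]
    exact div_pos (by linarith) (by positivity)
  have hae : 0 ≤ᵐ[volume] liYauIntegrand β (0 : EuclideanSpace ℝ (Fin d)) := by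
    filter_upwards [compl_mem_ae_iff.2 (measure_singleton (0 : EuclideanSpace ℝ (Fin d)))]
      with σ hσ using (hpos σ hσ).le
  have hint : 0 < ∫ σ : EuclideanSpace ℝ (Fin d), liYauIntegrand β 0 σ := by
    rw [integral_pos_iff_support_of_nonneg_ae hae (integrable_liYauIntegrand hd hβ 0)]
    have hsub : Metric.ball (0 : EuclideanSpace ℝ (Fin d)) 1 \ {0}
        ⊆ Function.support (liYauIntegrand β 0) := fun σ hσ => (hpos σ hσ.2).ne'
    refine lt_of_lt_of_le ?_ (measure_mono hsub)
    rw [measure_sdiff_null (measure_singleton 0)]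
    exact Metric.measure_ball_pos _ _ one_pos
  refine mul_pos (half_pos (fracConst_pos hβ)) (hint.trans_le ?_)
  exact le_ciSup (bddAbove_range_integral_liYauIntegrand hd hβ) 0

lemma fracLaplacian_log_stableKernel_le (hd : 1 ≤ d) (hβ : β ∈ Ioo (0 : ℝ) 2)
    (y : EuclideanSpace ℝ (Fin d)) :
    fracLaplacian β (fun z => log (stableKernel ((2 * π) ^ β) β z)) y ≤ liYauConst β d := by
  have h : fracLaplacian β (fun z => log (stableKernel ((2 * π) ^ β) β z)) y
      = fracConst β d / 2 * ∫ σ, liYauIntegrand β y σ := by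
    rw [liYauIntegrand_eq hd hβ, integral_neg, fracLaplacian, mul_neg]
  rw [h]
  exact mul_le_mul_of_nonneg_left (le_ciSup (bddAbove_range_integral_liYauIntegrand hd hβ) y)
    (half_pos (fracConst_pos hβ)).le

end FractionalLaplacian

theorem lemma3p1 (d : ℕ) (hd : 1 ≤ d) (β : ℝ) (hβ : β ∈ Set.Ioo (0 : ℝ) 2) :
    -- the kernel is positive, so that its logarithm is meaningful
    (∀ t : ℝ, 0 < t → ∀ x : EuclideanSpace ℝ (Fin d), 0 < fracHeatKernel β t x) ∧
    -- the constant is well defined, finite and positive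
    (∀ y : EuclideanSpace ℝ (Fin d), MeasureTheory.Integrable (liYauIntegrand β y)) ∧
    BddAbove (Set.range fun y : EuclideanSpace ℝ (Fin d) => ∫ σ, liYauIntegrand β y σ) ∧
    0 < liYauConst β d ∧
    -- the fractional Laplacian of the logarithm exists, in both forms, and obeys the bound
    ∀ t : ℝ, 0 < t → ∀ x : EuclideanSpace ℝ (Fin d),
      MeasureTheory.Integrable
        (secondDiffQuot β (fun z => Real.log (fracHeatKernel β t z)) x) ∧
      HasFracLaplacianPV β (fun z => Real.log (fracHeatKernel β t z)) x
        (fracLaplacian β (fun z => Real.log (fracHeatKernel β t z)) x) ∧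
      fracLaplacian β (fun z => Real.log (fracHeatKernel β t z)) x ≤ liYauConst β d / t := by
  have := nontrivial_euclideanSpace hd
  refine ⟨fun t ht x => ?_, integrable_liYauIntegrand hd hβ,
    bddAbove_range_integral_liYauIntegrand hd hβ, liYauConst_pos hd hβ, fun t ht x => ?_⟩
  · rw [fracHeatKernel_eq_stableKernel hd hβ.1 ht]
    exact stableKernel_pos (by positivity) hβ x
  · have hκ : 0 < t * (2 * π) ^ β := by positivity
    simp only [fracHeatKernel_eq_stableKernel hd hβ.1 ht]
    have hint := integrable_secondDiffQuot_log hd hβ hκ x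
    refine ⟨hint, hasFracLaplacianPV_of_integrable hd hint fun ε hε =>
      integrableOn_log_sub_div hd hβ hκ x hε, ?_⟩
    set R := t ^ (-β⁻¹) with hR
    have hR0 : 0 < R := by positivity
    have hlog : (fun z : EuclideanSpace ℝ (Fin d) => log (stableKernel (t * (2 * π) ^ β) β z))
        = fun z => log (R ^ Module.finrank ℝ (EuclideanSpace ℝ (Fin d)))
          + log (stableKernel ((2 * π) ^ β) β (R • z)) := by
      funext z
      rw [stableKernel_scaling hβ.1 ht z, Real.log_mul (by positivity)
        (stableKernel_pos (by positivity) hβ _).ne']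
    have hRβ : R ^ β = t⁻¹ := by
      rw [hR, ← Real.rpow_mul ht.le, neg_mul, inv_mul_cancel₀ hβ.1.ne', Real.rpow_neg_one]
    rw [hlog, fracLaplacian_comp_smul_add_const
      (f := fun z => log (stableKernel ((2 * π) ^ β) β z)) hR0, hRβ, inv_mul_eq_div]
    exact div_le_div_of_nonneg_right (fracLaplacian_log_stableKernel_le hd hβ _) ht.le
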